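/- **Theorem 1.** Let $S$ be a finite-dimensional quantum system with Hamiltonian $H_S$, and let $B$ be a bath (of finite or infinite dimension) with Hamiltonian $H_B$. Fix the Boltzmann constant $k>0$ and a temperature $T>0$, put $\beta=1/(kT)$, and assume that $Z_B=\mathrm{Tr}\,e^{-\beta H_B}<\infty$. Let $\tau_S=e^{-\beta H_S}/\mathrm{Tr}\,e^{-\beta H_S}$ and $\hat\tau_B=e^{-\beta H_B}/Z_B$ be the thermal states. Let $V$ be a unitary on $S\otimes B$ that conserves energy, $[V,H_S+H_B]=0$, and let $$\mathcal T(\cdot)=\mathrm{Tr}_B\big[V((\cdot)\otimes\hat\tau_B)V^\dagger\big],\qquad \mathcal R(\cdot)=\mathrm{Tr}_B\big[V^\dagger((\cdot)\otimes\hat\tau_B)V\big].$$ Let $\rho_S$ be a density operator on $S$ and $\sigma_S=\mathcal T(\rho_S)$. Then $\mathcal R$ is again a thermal operation (with the same bath), and $$D(\rho_S\|\tau_S)-D(\sigma_S\|\tau_S)\ \ge\ D(\rho_S\|\mathcal R(\sigma_S))\ \ge\ -\log F(\rho_S,\mathcal R(\sigma_S)).$$ Here $D(\rho\|\sigma)=\mathrm{Tr}[\rho\log\rho]-\mathrm{Tr}[\rho\log\sigma]$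 if $\mathrm{supp}\,\rho\subseteq\mathrm{supp}\,\sigma$ and $D(\rho\|\sigma)=+\infty$ otherwise, $F(\rho,\sigma)=\big(\mathrm{Tr}\sqrt{\sqrt\rho\,\sigma\sqrt\rho}\big)^2$, and $\log$ is the natural logarithm, for operators evaluated on the support. Moreover, let $W_{\rm gain}(\rho_S\to\sigma_S)$ be the work gained in the regime of the standard free energy, that is, the largest $W$ for which the transformation $\rho_S\otimes|0\rangle\langle0|_W\to\sigma_S\otimes|1\rangle\langle1|_W$, with a two-level battery of Hamiltonian $W|1\rangle\langle1|_W$, does not increase the free energy $\mathrm{Tr}[H\omega]+kT\,\mathrm{Tr}[\omega\log\omega]$, where $H=H_S+W|1\rangle\langle1|_W$. This maximum exists, and $$W_{\rm gain}(\rho_S\to\sigma_S)=kT\big(D(\rho_S\|\tau_S)-D(\sigma_S\|\tau_S)\big)\ \ge\ -kT\log F(\rho_S,\mathcal R(\sigma_S)).$$ -/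

import Mathlib

open scoped Kronecker ComplexOrder InnerProductSpace

noncomputable section

namespace ThermalOp

/-! ### States of a finite-dimensional system -/

/-- Density matrices. -/
def IsDensity {m : Type*} [Fintype m] [DecidableEq m] (ρ : Matrix m m ℂ) : Prop :=
  ρ.PosSemidef ∧ ρ.trace = 1

/-- The operator logarithm of a Hermitian matrix, evaluated on the support of its argument
(`Real.log 0 = 0`, so it vanishes on the kernel). -/
def matLog {m : Type*} [Fintype m] [DecidableEq m] (A : Matrix m m ℂ) : Matrix m m ℂ :=
  cfc Real.log A

/-- The square root of a positive semidefinite matrix. -/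
def matSqrt {m : Type*} [Fintype m] [DecidableEq m] (A : Matrix m m ℂ) : Matrix m m ℂ :=
  cfc Real.sqrt A

/-- The quantum relative entropy `D(ρ‖σ) = Tr[ρ log ρ] - Tr[ρ log σ]` if
`supp ρ ⊆ supp σ`, and `+∞` otherwise. The support of a Hermitian matrix is its range. -/
def relEntropy {m : Type*} [Fintype m] [DecidableEq m] (ρ σ : Matrix m m ℂ) : EReal :=
  open Classical in
  if LinearMap.range ρ.mulVecLin ≤ LinearMap.range σ.mulVecLin then
    (((ρ * matLog ρ).trace.re - (ρ * matLog σ).trace.re : ℝ) : EReal)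
  else ⊤

/-- The fidelity `F(ρ, σ) = (Tr √(√ρ σ √ρ))²`. -/
def fidelity {m : Type*} [Fintype m] [DecidableEq m] (ρ σ : Matrix m m ℂ) : ℝ :=
  (matSqrt (matSqrt ρ * σ * matSqrt ρ)).trace.re ^ 2

/-- `-log F(ρ, σ)`, with the value `+∞` when the fidelity is zero. -/
def negLogFidelity {m : Type*} [Fintype m] [DecidableEq m] (ρ σ : Matrix m m ℂ) : EReal :=
  -ENNReal.log (ENNReal.ofReal (fidelity ρ σ))

/-- The thermal state `exp(-βH) / Tr exp(-βH)`. -/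
def gibbs {m : Type*} [Fintype m] [DecidableEq m] (β : ℝ) (H : Matrix m m ℂ) : Matrix m m ℂ :=
  (NormedSpace.exp (-(β : ℂ) • H)).trace⁻¹ • NormedSpace.exp (-(β : ℂ) • H)

/-! ### Free energy and work

The battery is a two-level system with ground state `|0⟩` of energy `0` and excited state
`|1⟩` of energy `W`. -/

/-- The von Neumann entropy `S(ω) = -Tr[ω log ω]`. -/
def entropy {m : Type*} [Fintype m] [DecidableEq m] (ω : Matrix m m ℂ) : ℝ :=
  -(ω * matLog ω).trace.re

/-- The Helmholtz free energy `Tr[Hω] - kT S(ω)`; the argument `kT` is the product of the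
Boltzmann constant and the temperature. -/
def freeEnergy {m : Type*} [Fintype m] [DecidableEq m] (kT : ℝ) (H ω : Matrix m m ℂ) : ℝ :=
  (H * ω).trace.re - kT * entropy ω

/-- The projector `|i⟩⟨i|` on a level of the battery. -/
def batteryLevel (i : Fin 2) : Matrix (Fin 2) (Fin 2) ℂ := Matrix.single i i 1

/-- The Hamiltonian `H_S + W |1⟩⟨1|` of system and battery. -/
def systemBatteryHamiltonian {n : Type*} [Fintype n] [DecidableEq n] (H : Matrix n n ℂ) (W : ℝ) :
    Matrix (n × Fin 2) (n × Fin 2) ℂ :=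
  H ⊗ₖ (1 : Matrix (Fin 2) (Fin 2) ℂ) + (1 : Matrix n n ℂ) ⊗ₖ ((W : ℂ) • batteryLevel 1)

/-- The values `W` for which the standard second law allows the transformation
`ρ ⊗ |0⟩⟨0| → σ ⊗ |1⟩⟨1|`, that is, for which it does not increase the free energy. -/
def allowedWork {n : Type*} [Fintype n] [DecidableEq n] (kT : ℝ) (H ρ σ : Matrix n n ℂ) : Set ℝ :=
  {W | freeEnergy kT (systemBatteryHamiltonian H W) (σ ⊗ₖ batteryLevel 1) ≤
    freeEnergy kT (systemBatteryHamiltonian H W) (ρ ⊗ₖ batteryLevel 0)}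

/-- The work gained by the transformation `ρ → σ` in the regime of the standard free energy:
the largest allowed value. -/
def workGain {n : Type*} [Fintype n] [DecidableEq n] (kT : ℝ) (H ρ σ : Matrix n n ℂ) : ℝ :=
  sSup (allowedWork kT H ρ σ)

/-! ### The bath

The bath has a Hilbert space `K` of finite or infinite dimension. A bath Hamiltonian `H_B` for
which the partition function is finite has an orthonormal basis of eigenvectors; it is given by
such a basis `b` and the eigenvalues `E`, that is `H_B (b k) = E k • b k`. The space of system
and bath is `ℂⁿ ⊗ K = (n → K)`, and its bounded operators are the `n × n` matrices with entries
in the bounded operators of `K`. -/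

section Bath

variable {n κ K : Type*} [Fintype n] [DecidableEq n]
  [NormedAddCommGroup K] [InnerProductSpace ℂ K] [CompleteSpace K]

/-- The partition function `Z_B = Tr exp(-β H_B)`. -/
def bathPartition (E : κ → ℝ) (β : ℝ) : ℝ := ∑' k, Real.exp (-β * E k)

/-- The thermal state `exp(-β H_B) / Z_B` of the bath: the operator
`∑ₖ (exp(-β Eₖ) / Z_B) |bₖ⟩⟨bₖ|`. The series converges absolutely in the operator norm when
the partition function is finite. -/
def bathGibbs (b : HilbertBasis κ ℂ K) (E : κ → ℝ) (β : ℝ) : K →L[ℂ] K :=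
  ∑' k, ((Real.exp (-β * E k) / bathPartition E β : ℝ) : ℂ) •
    InnerProductSpace.rankOne ℂ (b k) (b k)

/-- The operator `X ⊗ A` on `ℂⁿ ⊗ K`. -/
def tensorOp (X : Matrix n n ℂ) (A : K →L[ℂ] K) : Matrix n n (K →L[ℂ] K) :=
  Matrix.of fun s t => X s t • A

/-- The partial trace over the bath of a trace-class operator on `ℂⁿ ⊗ K`. -/
def traceBath (b : HilbertBasis κ ℂ K) (X : Matrix n n (K →L[ℂ] K)) : Matrix n n ℂ :=
  Matrix.of fun s t => ∑' k, ⟪b k, X s t (b k)⟫_ℂ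

/-- The action of an operator on a vector of `ℂⁿ ⊗ K = (n → K)`. -/
def applyOp (V : Matrix n n (K →L[ℂ] K)) (ψ : n → K) : n → K :=
  fun s => ∑ t, V s t (ψ t)

/-- The graph of the (in general unbounded) self-adjoint operator `H_S ⊗ 1 + 1 ⊗ H_B`:
`ψ` is in its domain and `φ = (H_S ⊗ 1 + 1 ⊗ H_B) ψ`. -/
def TotalEnergyGraph (b : HilbertBasis κ ℂ K) (E : κ → ℝ) (H : Matrix n n ℂ)
    (ψ φ : n → K) : Prop :=
  ∀ s k, ⟪b k, φ s⟫_ℂ = ∑ t, H s t * ⟪b k, ψ t⟫_ℂ + (E k : ℂ) * ⟪b k, ψ s⟫_ℂ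

/-- `[V, H_S + H_B] = 0`: the operator `V` maps the domain of `H_S + H_B` into itself and
commutes with `H_S + H_B` there. -/
def CommutesWithEnergy (b : HilbertBasis κ ℂ K) (E : κ → ℝ) (H : Matrix n n ℂ)
    (V : Matrix n n (K →L[ℂ] K)) : Prop :=
  ∀ ψ φ : n → K, TotalEnergyGraph b E H ψ φ →
    TotalEnergyGraph b E H (applyOp V ψ) (applyOp V φ)

/-- Energy-conserving unitaries on system and bath. -/
def IsEnergyConservingUnitary (b : HilbertBasis κ ℂ K) (E : κ → ℝ) (H : Matrix n n ℂ)
    (V : Matrix n n (K →L[ℂ] K)) : Prop :=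
  V ∈ unitary (Matrix n n (K →L[ℂ] K)) ∧ CommutesWithEnergy b E H V

/-- The map `X ↦ Tr_B[V (X ⊗ τ_B) V†]`. -/
def thermalMap (b : HilbertBasis κ ℂ K) (E : κ → ℝ) (β : ℝ) (V : Matrix n n (K →L[ℂ] K))
    (X : Matrix n n ℂ) : Matrix n n ℂ :=
  traceBath b (V * tensorOp X (bathGibbs b E β) * star V)

/-- The map `X ↦ Tr_B[V† (X ⊗ τ_B) V]`. -/
def recoveryMap (b : HilbertBasis κ ℂ K) (E : κ → ℝ) (β : ℝ) (V : Matrix n n (K →L[ℂ] K))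
    (X : Matrix n n ℂ) : Matrix n n ℂ :=
  traceBath b (star V * tensorOp X (bathGibbs b E β) * V)

/-- Thermal operations on the system, at inverse temperature `β` and with the given bath. -/
def IsThermalOperation (b : HilbertBasis κ ℂ K) (E : κ → ℝ) (β : ℝ) (H : Matrix n n ℂ)
    (T : Matrix n n ℂ → Matrix n n ℂ) : Prop :=
  ∃ U : Matrix n n (K →L[ℂ] K), IsEnergyConservingUnitary b E H U ∧
    ∀ X, T X = thermalMap b E β U X

end Bath

end ThermalOp

end

/-! On system and bath, compare `ρ ⊗ τ_B` with `V†(σ ⊗ τ_B)V`. Tracing out the bath gives `ρ` and `R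
σ`, so monotonicity of the relative entropy under the partial trace bounds `D(ρ‖R σ)` by the
relative entropy of the joint states. By unitary invariance the latter is `Tr[ρ log ρ] - Tr[σ log σ]
+ δ`, where `δ` is `β` times the mean energy gained by the bath. Energy conservation turns `δ` into
`β (Tr[Hρ] - Tr[Hσ])`, and the sum is `D(ρ‖τ) - D(σ‖τ)` because `log τ = -βH - log Z`.

The joint states are never formed, since the bath may be infinite-dimensional. The blocks
`⟨b_l|V|b_k⟩` are Kraus operators `A a`, `a = (k, l)`, with the thermal weight of `k` as `p a` and
that of `l` as `q a`; the recovery map uses the adjoint blocks with `q a` (`hasSum_thermalMap`,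
`hasSum_recoveryMap`). Monotonicity is proved for such families in `relEntropy_recovered_le`.
Integrated over `t`, the expressions `∑ r² |⟨w_j|u_i⟩|² / (s + t r)` give the relative entropy as
both cutoffs are removed. Each of them is the maximum of a quadratic functional of a matrix `Z`
(`quadratic_le`, `exists_quadratic_eq`), and inserting `A a * Z` in the joint functional gives the
inequality at every `t`. `hasSum_heat` evaluates `δ`.

The fidelity bound combines Jensen's inequality, `exp(-D/2) ≤ Tr √σ√ρ`, with `Re Tr M ≤ Tr |M|`. For
the work, the battery remains in pure energy levels, so the free-energy condition is linear in `W`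
and the allowed values form a closed half-line. -/

noncomputable section

namespace ThermalOp

open Matrix Filter Topology

/-! ### Functional calculus and traces in diagonalized form. -/

section Spectral

variable {m : Type*} [Fintype m] [DecidableEq m]

/-- The matrix `U diag(d) U†`. -/
def diagConj (U : Matrix m m ℂ) (d : m → ℝ) : Matrix m m ℂ :=
  U * diagonal (fun i => (d i : ℂ)) * Uᴴ

lemma diagConj_isHermitian (U : Matrix m m ℂ) (d : m → ℝ) : (diagConj U d).IsHermitian := by
  unfold diagConj
  apply isHermitian_mul_mul_conjTranspose
  rw [isHermitian_diagonal_iff]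
  intro i
  simp [isSelfAdjoint_iff]

lemma diagConj_mul {U : Matrix m m ℂ} (hU : Uᴴ * U = 1) (d e : m → ℝ) :
    diagConj U d * diagConj U e = diagConj U (fun i => d i * e i) := by
  unfold diagConj
  calc _ = U * diagonal (fun i => (d i : ℂ)) * (Uᴴ * U) * diagonal (fun i => (e i : ℂ)) * Uᴴ := by
        simp only [Matrix.mul_assoc]
    _ = _ := by
        rw [hU, Matrix.mul_one, Matrix.mul_assoc U, diagonal_mul_diagonal]
        simp

lemma diagConj_one {U : Matrix m m ℂ} (hU : Uᴴ * U = 1) : diagConj U (fun _ => 1) = 1 := by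
  unfold diagConj
  simp [mul_eq_one_comm.mp hU]

lemma aeval_diagConj {U : Matrix m m ℂ} (hU : Uᴴ * U = 1) (d : m → ℝ) (p : Polynomial ℝ) :
    Polynomial.aeval (diagConj U d) p = diagConj U (fun i => p.eval (d i)) := by
  induction p using Polynomial.induction_on' with
  | add p q hp hq =>
    rw [map_add, hp, hq]
    unfold diagConj
    rw [← Matrix.add_mul, ← Matrix.mul_add, diagonal_add]
    simp
  | monomial k a =>
    have hpow : ∀ k : ℕ, diagConj U d ^ k = diagConj U (fun i => d i ^ k) := by
      intro k
      induction k with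
      | zero => simp [diagConj_one hU]
      | succ k ih => rw [pow_succ, ih, diagConj_mul hU]; simp [pow_succ]
    rw [Polynomial.aeval_monomial, hpow]
    unfold diagConj
    rw [Algebra.algebraMap_eq_smul_one, smul_mul_assoc, one_mul, ← Matrix.smul_mul,
      ← Matrix.mul_smul]
    congr 2
    ext i j
    by_cases h : i = j
    · subst h; simp
    · simp [h]

lemma exists_diagConj {A : Matrix m m ℂ} (hA : A.IsHermitian) :
    ∃ (U : Matrix m m ℂ) (d : m → ℝ), Uᴴ * U = 1 ∧ A = diagConj U d := by
  refine ⟨hA.eigenvectorUnitary, hA.eigenvalues, ?_, ?_⟩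
  · exact Unitary.coe_star_mul_self hA.eigenvectorUnitary
  · conv_lhs => rw [hA.spectral_theorem]
    rfl

lemma spectrum_diagConj_subset {U : Matrix m m ℂ} (hU : Uᴴ * U = 1) (d : m → ℝ) :
    spectrum ℝ (diagConj U d) ⊆ Set.range d := by
  intro x hx
  by_contra hne
  apply hx
  have hd : ∀ i, x - d i ≠ 0 := fun i h => hne ⟨i, by linarith⟩
  have h1 : algebraMap ℝ (Matrix m m ℂ) x - diagConj U d = diagConj U (fun i => x - d i) := by
    have := aeval_diagConj hU d (Polynomial.C x - Polynomial.X)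
    simpa using this
  rw [spectrum.mem_resolventSet_iff, h1]
  refine IsUnit.of_mul_eq_one (diagConj U (fun i => (x - d i)⁻¹)) ?_
  rw [diagConj_mul hU]
  simp [mul_inv_cancel₀ (hd _), diagConj_one hU]

/-- The functional calculus of a matrix in diagonalized form. -/
lemma cfc_diagConj {U : Matrix m m ℂ} (hU : Uᴴ * U = 1) (d : m → ℝ) (f : ℝ → ℝ) :
    cfc f (diagConj U d) = diagConj U (fun i => f (d i)) := by
  -- On the finite spectrum `f` agrees with a polynomial, so `f` need not be continuous; this
  -- matters for `Real.log` at `0`.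
  set s : Finset ℝ := Finset.univ.image d
  set p := Lagrange.interpolate s id f
  have hp : ∀ i, p.eval (d i) = f (d i) := fun i =>
    Lagrange.eval_interpolate_at_node (s := s) (v := id) f (Set.injOn_id _)
      (Finset.mem_image_of_mem d (Finset.mem_univ i))
  have h1 : cfc f (diagConj U d) = cfc p.eval (diagConj U d) := by
    apply cfc_congr
    intro x hx
    obtain ⟨i, rfl⟩ := spectrum_diagConj_subset hU d hx
    exact (hp i).symm
  rw [h1, cfc_polynomial p _ (diagConj_isHermitian U d).isSelfAdjoint, aeval_diagConj hU]
  simp only [hp]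

lemma conjTranspose_mul_diagConj_mul {U : Matrix m m ℂ} (hU : Uᴴ * U = 1) (d : m → ℝ) :
    Uᴴ * diagConj U d * U = diagonal (fun i => (d i : ℂ)) := by
  unfold diagConj
  calc _ = (Uᴴ * U) * diagonal (fun i => (d i : ℂ)) * (Uᴴ * U) := by simp only [Matrix.mul_assoc]
    _ = _ := by simp [hU]

lemma diagConj_nonneg {U : Matrix m m ℂ} (hU : Uᴴ * U = 1) {d : m → ℝ}
    (h : (diagConj U d).PosSemidef) (i : m) : 0 ≤ d i := by
  have := h.conjTranspose_mul_mul_same U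
  rw [conjTranspose_mul_diagConj_mul hU, posSemidef_diagonal_iff] at this
  simpa using this i

/-- The trace of a product of operators in terms of matrix elements between eigenvectors. -/
lemma trace_diagConj_mul (W U M N : Matrix m m ℂ) (a c : m → ℝ) :
    (diagConj W a * M * diagConj U c * Nᴴ).trace =
      ∑ j, ∑ i, (a j : ℂ) * c i * (Wᴴ * M * U) j i * star ((Wᴴ * N * U) j i) := by
  have h1 : (diagConj W a * M * diagConj U c * Nᴴ).trace =
      (diagonal (fun i => (a i : ℂ)) * (Wᴴ * M * U) * diagonal (fun i => (c i : ℂ)) *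
        (Wᴴ * N * U)ᴴ).trace := by
    unfold diagConj
    rw [Matrix.mul_assoc W, Matrix.mul_assoc W, Matrix.mul_assoc W, Matrix.mul_assoc W,
      trace_mul_comm W]
    simp only [conjTranspose_mul, conjTranspose_conjTranspose, Matrix.mul_assoc]
  rw [h1, trace]
  refine Finset.sum_congr rfl fun j _ => ?_
  rw [diag_apply, mul_apply]
  refine Finset.sum_congr rfl fun i _ => ?_
  rw [mul_diagonal, diagonal_mul, conjTranspose_apply]
  ring

lemma trace_diagConj_mul_self (W U M : Matrix m m ℂ) (a c : m → ℝ) :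
    (diagConj W a * M * diagConj U c * Mᴴ).trace =
      ((∑ j, ∑ i, a j * c i * Complex.normSq ((Wᴴ * M * U) j i) : ℝ) : ℂ) := by
  rw [trace_diagConj_mul]
  push_cast
  refine Finset.sum_congr rfl fun j _ => Finset.sum_congr rfl fun i _ => ?_
  rw [mul_assoc, ← Complex.mul_conj]
  rfl


end Spectral

/-! ### Supports, expressed through kernels. -/

section Support

variable {m : Type*} [Fintype m] [DecidableEq m]

/-- Supports are handled below as kernel inclusions, tested on matrices `N`; this converts them to
the range condition of `relEntropy`. -/
lemma range_mulVecLin_le {ρ σ : Matrix m m ℂ} (hρ : ρ.IsHermitian) (hσ : σ.IsHermitian)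
    (h : ∀ N : Matrix m m ℂ, σ * N = 0 → ρ * N = 0) :
    LinearMap.range ρ.mulVecLin ≤ LinearMap.range σ.mulVecLin := by
  obtain ⟨U, d, hU, rfl⟩ := exists_diagConj hσ
  -- The convention `0⁻¹ = 0` makes `P` the pseudo-inverse of `σ`.
  set P := diagConj U (fun i => (d i)⁻¹)
  have h1 : diagConj U d * P * diagConj U d = diagConj U d := by
    rw [diagConj_mul hU, diagConj_mul hU]
    congr 1
    ext i
    exact mul_inv_mul_cancel (d i)
  have h2 : ρ * (1 - P * diagConj U d) = 0 := by
    apply h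
    rw [Matrix.mul_sub, ← Matrix.mul_assoc, h1, Matrix.mul_one, sub_self]
  have h3 : ρ = ρ * P * diagConj U d := by
    rw [Matrix.mul_sub, sub_eq_zero, Matrix.mul_one] at h2
    rw [Matrix.mul_assoc, ← h2]
  have h4 : ρ = diagConj U d * (P * ρ) := by
    have := congrArg conjTranspose h3
    rwa [conjTranspose_mul, conjTranspose_mul, hρ.eq, hσ.eq, (diagConj_isHermitian _ _).eq] at this
  rw [h4, mulVecLin_mul]
  exact LinearMap.range_comp_le_range _ _

/-- The trace is the squared Hilbert-Schmidt norm of `√σ M`. -/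
lemma mul_eq_zero_of_trace_eq_zero {σ M : Matrix m m ℂ} (hσ : σ.PosSemidef)
    (h : (Mᴴ * σ * M).trace.re = 0) : σ * M = 0 := by
  obtain ⟨U, d, hU, rfl⟩ := exists_diagConj hσ.1
  have hd := diagConj_nonneg hU hσ
  set K := diagConj U (fun i => √(d i))
  have hK : K * K = diagConj U d := by
    rw [diagConj_mul hU]
    congr 1
    ext i
    exact Real.mul_self_sqrt (hd i)
  have h0 : (Mᴴ * diagConj U d * M).PosSemidef := hσ.conjTranspose_mul_mul_same M
  have h1 : (Mᴴ * diagConj U d * M).trace = 0 :=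
    Complex.ext h ((Complex.nonneg_iff.mp h0.trace_nonneg).2.symm)
  have h2 : (K * M)ᴴ * (K * M) = Mᴴ * diagConj U d * M := by
    rw [conjTranspose_mul, (diagConj_isHermitian _ _).eq, ← hK]
    simp only [Matrix.mul_assoc]
    rfl
  rw [← h2, trace_conjTranspose_mul_self_eq_zero_iff] at h1
  rw [← hK, Matrix.mul_assoc, h1, Matrix.mul_zero]

/-- The kernel inclusion is tested on the eigenvector `W e_j`. It shows that terms with a vanishing
eigenvalue `s j` carry no weight, where `log (s j)` would otherwise diverge. Used with `M` a Kraus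
operator and with `M = 1`. -/
lemma entry_eq_zero_of_mul_eq_zero {U W M : Matrix m m ℂ} (hU : Uᴴ * U = 1) (hW : Wᴴ * W = 1)
    {r s : m → ℝ}
    (h : ∀ N : Matrix m m ℂ, diagConj W s * N = 0 → diagConj U r * (Mᴴ * N) = 0)
    {i j : m} (hj : s j = 0) : (r i : ℂ) * (Wᴴ * M * U) j i = 0 := by
  have h1 : diagConj W s * (W * single j j 1) = 0 := by
    unfold diagConj
    rw [Matrix.mul_assoc, ← Matrix.mul_assoc Wᴴ, hW, Matrix.one_mul, Matrix.mul_assoc]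
    have : diagonal (fun i => (s i : ℂ)) * single j j 1 = 0 := by
      ext a c
      by_cases ha : a = j
      · simp [diagonal_mul, ha, hj]
      · simp [diagonal_mul, single_apply_of_row_ne (Ne.symm ha)]
    rw [this, Matrix.mul_zero]
  have h2 := h _ h1
  have h3 : diagonal (fun i => (r i : ℂ)) * ((Wᴴ * M * U)ᴴ * single j j 1) = 0 := by
    calc _ = Uᴴ * (diagConj U r * (Mᴴ * (W * single j j 1))) := by
          unfold diagConj
          rw [← Matrix.mul_assoc Uᴴ, ← Matrix.mul_assoc Uᴴ, ← Matrix.mul_assoc Uᴴ, hU,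
            Matrix.one_mul]
          simp only [conjTranspose_mul, conjTranspose_conjTranspose, Matrix.mul_assoc]
      _ = 0 := by rw [h2, Matrix.mul_zero]
  have h4 := congrFun (congrFun h3 i) j
  rw [diagonal_mul, mul_single_apply_same, conjTranspose_apply] at h4
  rcases mul_eq_zero.mp h4 with h5 | h5
  · rw [h5, zero_mul]
  · rw [mul_one, star_eq_zero] at h5
    rw [h5, mul_zero]

end Support

/-! ### A variational formula for resolvents of the relative modular operator. -/

section Functional

variable {m : Type*} [Fintype m] [DecidableEq m]

/-- Completing the square in `d`. If `S + t * R = 0`, then `R = 0`, and both sides vanish because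
division by zero gives `0`. -/
lemma two_mul_re_sub_le (b d : ℂ) {R S t : ℝ} (hR : 0 ≤ R) (hS : 0 ≤ S) (ht : 0 < t) :
    2 * (R * (b * star d)).re - (S + t * R) * Complex.normSq d ≤
      R ^ 2 * Complex.normSq b / (S + t * R) := by
  have htR := mul_nonneg ht.le hR
  rcases (add_nonneg hS htR).eq_or_lt with h | h
  · have hR0 : R = 0 := by
      have : t * R = 0 := by linarith
      rcases mul_eq_zero.mp this with h | h
      · linarith
      · exact h
    rw [← h, hR0]
    simp
  · rw [le_div_iff₀ h]
    simp only [Complex.normSq_apply, Complex.mul_re, Complex.ofReal_re, Complex.ofReal_im,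
      Complex.star_def, Complex.conj_re, Complex.conj_im, zero_mul, sub_zero]
    nlinarith [sq_nonneg (R * b.re - (S + t * R) * d.re), sq_nonneg (R * b.im - (S + t * R) * d.im)]

/-- The maximizer of the preceding square, `d = R b / (S + t R)`. -/
lemma two_mul_re_sub_eq (b : ℂ) {R S t : ℝ} (hR : 0 ≤ R) (hS : 0 ≤ S) (ht : 0 < t) :
    2 * (R * (b * star (((R / (S + t * R) : ℝ) : ℂ) * b))).re -
      (S + t * R) * Complex.normSq (((R / (S + t * R) : ℝ) : ℂ) * b) =
      R ^ 2 * Complex.normSq b / (S + t * R) := by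
  have htR := mul_nonneg ht.le hR
  rcases (add_nonneg hS htR).eq_or_lt with h | h
  · rw [← h]
    simp
  · rw [star_mul', mul_left_comm b, Complex.star_def, Complex.conj_ofReal,
      Complex.mul_conj, ← Complex.ofReal_mul, ← Complex.ofReal_mul, Complex.ofReal_re,
      Complex.normSq_mul, Complex.normSq_ofReal]
    field_simp
    ring

/-- A quadratic functional of `N` whose supremum is a resolvent of the relative modular
operator, in terms of matrix elements between eigenvectors. -/
lemma quadratic_eq_sum {U W : Matrix m m ℂ} (hU : Uᴴ * U = 1) (hW : Wᴴ * W = 1) (r s : m → ℝ)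
    (M N : Matrix m m ℂ) (p q t : ℝ) :
    2 * (p * (M * diagConj U r * Nᴴ).trace.re) - q * (diagConj W s * N * Nᴴ).trace.re -
      t * (p * (N * diagConj U r * Nᴴ).trace.re) =
    ∑ j, ∑ i, (2 * (((p * r i : ℝ) : ℂ) * ((Wᴴ * M * U) j i * star ((Wᴴ * N * U) j i))).re -
      (q * s j + t * (p * r i)) * Complex.normSq ((Wᴴ * N * U) j i)) := by
  have h1 := trace_diagConj_mul W U M N (fun _ => 1) r
  have h2 := trace_diagConj_mul_self W U N s (fun _ => 1)
  have h3 := trace_diagConj_mul_self W U N (fun _ => 1) r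
  rw [diagConj_one hW, Matrix.one_mul] at h1 h3
  rw [diagConj_one hU, Matrix.mul_one] at h2
  rw [h1, h2, h3, Complex.ofReal_re, Complex.ofReal_re, Complex.re_sum]
  simp only [Complex.re_sum, Finset.mul_sum, ← Finset.sum_sub_distrib]
  refine Finset.sum_congr rfl fun j _ => Finset.sum_congr rfl fun i _ => ?_
  rw [Complex.ofReal_one, one_mul, mul_assoc, Complex.re_ofReal_mul, Complex.re_ofReal_mul]
  ring

/-- The upper half of the variational formula, used for the joint states with an arbitrary trial
matrix; `exists_quadratic_eq` supplies the maximizer for the system alone. -/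
lemma quadratic_le {U W : Matrix m m ℂ} (hU : Uᴴ * U = 1) (hW : Wᴴ * W = 1) {r s : m → ℝ}
    (hr : ∀ i, 0 ≤ r i) (hs : ∀ i, 0 ≤ s i) (M N : Matrix m m ℂ) {p q t : ℝ} (hp : 0 ≤ p)
    (hq : 0 ≤ q) (ht : 0 < t) :
    2 * (p * (M * diagConj U r * Nᴴ).trace.re) - q * (diagConj W s * N * Nᴴ).trace.re -
      t * (p * (N * diagConj U r * Nᴴ).trace.re) ≤
    ∑ j, ∑ i, (p * r i) ^ 2 * Complex.normSq ((Wᴴ * M * U) j i) / (q * s j + t * (p * r i)) := by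
  rw [quadratic_eq_sum hU hW]
  exact Finset.sum_le_sum fun j _ => Finset.sum_le_sum fun i _ =>
    two_mul_re_sub_le _ _ (mul_nonneg hp (hr i)) (mul_nonneg hq (hs j)) ht

lemma exists_quadratic_eq {U W : Matrix m m ℂ} (hU : Uᴴ * U = 1) (hW : Wᴴ * W = 1) {r s : m → ℝ}
    (hr : ∀ i, 0 ≤ r i) (hs : ∀ i, 0 ≤ s i) {t : ℝ} (ht : 0 < t) :
    ∃ Z : Matrix m m ℂ, 2 * (diagConj U r * Zᴴ).trace.re - (diagConj W s * Z * Zᴴ).trace.re -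
      t * (Z * diagConj U r * Zᴴ).trace.re =
    ∑ j, ∑ i, r i ^ 2 * Complex.normSq ((Wᴴ * U) j i) / (s j + t * r i) := by
  set D : Matrix m m ℂ := Matrix.of fun j i => ((r i / (s j + t * r i) : ℝ) : ℂ) * (Wᴴ * U) j i
  refine ⟨W * D * Uᴴ, ?_⟩
  have hD : Wᴴ * (W * D * Uᴴ) * U = D := by
    calc _ = (Wᴴ * W) * D * (Uᴴ * U) := by simp only [Matrix.mul_assoc]
      _ = D := by rw [hU, hW, Matrix.one_mul, Matrix.mul_one]
  have h := quadratic_eq_sum hU hW r s 1 (W * D * Uᴴ) 1 1 t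
  rw [hD] at h
  simp only [one_mul, Matrix.mul_one] at h
  rw [h]
  refine Finset.sum_congr rfl fun j _ => Finset.sum_congr rfl fun i _ => ?_
  exact two_mul_re_sub_eq _ (hr i) (hs j) ht

end Functional

/-! ### Logarithms as integrals of resolvents. -/

section Integral

lemma integral_sq_div_add_mul {R S ε N : ℝ} (hR : 0 ≤ R) (hS : 0 ≤ S) (hε : 0 < ε) (hN : ε ≤ N) :
    ∫ t in ε..N, R ^ 2 / (S + t * R) = R * Real.log ((S + N * R) / (S + ε * R)) := by
  rcases hR.eq_or_lt with rfl | hR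
  · simp
  have hpos : ∀ t, ε ≤ t → 0 < S + t * R := fun t ht =>
    add_pos_of_nonneg_of_pos hS (mul_pos (hε.trans_le ht) hR)
  rw [Real.log_div (hpos N hN).ne' (hpos ε le_rfl).ne', mul_sub]
  have hderiv : ∀ t ∈ Set.uIcc ε N,
      HasDerivAt (fun t => R * Real.log (S + t * R)) (R ^ 2 / (S + t * R)) t := by
    intro t ht
    rw [Set.uIcc_of_le hN] at ht
    have h1 : HasDerivAt (fun t => S + t * R) R t := by
      simpa using ((hasDerivAt_id t).mul_const R).const_add S
    rw [sq, mul_div_assoc]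
    exact (h1.log (hpos t ht.1).ne').const_mul R
  refine intervalIntegral.integral_eq_sub_of_hasDerivAt hderiv ?_
  apply ContinuousOn.intervalIntegrable
  rw [Set.uIcc_of_le hN]
  apply ContinuousOn.div (by fun_prop) (by fun_prop)
  exact fun t ht => (hpos t ht.1).ne'

lemma continuousOn_sq_div_add_mul {R S ε N : ℝ} (hR : 0 ≤ R) (hS : 0 ≤ S) (hε : 0 < ε) :
    ContinuousOn (fun t => R ^ 2 / (S + t * R)) (Set.Icc ε N) := by
  rcases hR.eq_or_lt with rfl | hR
  · simpa using continuousOn_const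
  apply ContinuousOn.div (by fun_prop) (by fun_prop)
  exact fun t ht => (add_pos_of_nonneg_of_pos hS (mul_pos (hε.trans_le ht.1) hR)).ne'

/-- Dropping `ε` from the denominator and using `log (1 + u) ≤ u` leaves the error `q s x / N`. Its
sum over the Kraus index and the eigenvectors is `1 / N`, so it vanishes in the limit. -/
lemma mul_log_le {p q r s x ε N : ℝ} (hp : 0 < p) (hq : 0 < q) (hr : 0 ≤ r) (hs : 0 ≤ s)
    (hx : 0 ≤ x) (hsupp : s = 0 → r * x = 0) (hε : 0 < ε) (hN : ε ≤ N) :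
    x * (p * r * Real.log ((q * s + N * (p * r)) / (q * s + ε * (p * r)))) ≤
      Real.log N * (p * (r * x)) + p * (r * Real.log r * x) - p * (Real.log s * r * x) +
        (Real.log p - Real.log q) * (p * (r * x)) + q * (s * x) / N := by
  have hN0 := hε.trans_le hN
  by_cases h0 : r * x = 0
  · have : 0 ≤ q * (s * x) / N := by positivity
    rcases mul_eq_zero.mp h0 with rfl | rfl
    · simpa using this
    · simp
  have hr' : 0 < r := hr.lt_of_ne (fun h => h0 (by rw [← h, zero_mul]))
  have hx' : 0 < x := hx.lt_of_ne (fun h => h0 (by rw [← h, mul_zero]))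
  have hs' : 0 < s := hs.lt_of_ne (fun h => h0 (hsupp h.symm))
  have h1 : Real.log ((q * s + N * (p * r)) / (q * s + ε * (p * r))) ≤
      Real.log N + Real.log p + Real.log r - Real.log q - Real.log s + q * s / (N * (p * r)) := by
    calc _ ≤ Real.log ((q * s + N * (p * r)) / (q * s)) := by
          apply Real.log_le_log (by positivity)
          gcongr
          exact le_add_of_nonneg_right (by positivity)
      _ = Real.log ((N * (p * r)) / (q * s)) + Real.log (q * s / (N * (p * r)) + 1) := by
          rw [← Real.log_mul (by positivity) (by positivity)]
          congr 1
          field_simp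
      _ ≤ Real.log ((N * (p * r)) / (q * s)) + q * s / (N * (p * r)) := by
          gcongr
          have := Real.log_le_sub_one_of_pos (show 0 < q * s / (N * (p * r)) + 1 by positivity)
          linarith
      _ = _ := by
          rw [Real.log_div (by positivity) (by positivity), Real.log_mul hN0.ne' (by positivity),
            Real.log_mul hp.ne' hr'.ne', Real.log_mul hq.ne' hs'.ne']
          ring
  calc _ ≤ x * (p * r * (Real.log N + Real.log p + Real.log r - Real.log q - Real.log s +
        q * s / (N * (p * r)))) := by gcongr
    _ = _ := by
        field_simp
        ring

end Integral

/-! ### Monotonicity of the relative entropy for countable Kraus families. -/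

section Kraus

variable {m ι : Type*} [Fintype m] [DecidableEq m]

lemma hasSum_re_trace {f : ι → Matrix m m ℂ} {F : Matrix m m ℂ} (h : HasSum f F)
    (M : Matrix m m ℂ) : HasSum (fun a => (f a * M).trace.re) (F * M).trace.re := by
  have hc : Continuous fun X : Matrix m m ℂ => (X * M).trace.re :=
    Complex.continuous_re.comp ((continuous_id.matrix_mul continuous_const).matrix_trace)
  exact h.map ({ toFun := fun X => (X * M).trace.re
                 map_zero' := by simp
                 map_add' := fun X Y => by rw [Matrix.add_mul, trace_add, Complex.add_re] } :
    Matrix m m ℂ →+ ℝ) hc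

lemma hasSum_mul_re_trace {f : ι → Matrix m m ℂ} {p : ι → ℝ} {F : Matrix m m ℂ}
    (h : HasSum (fun a => (p a : ℂ) • f a) F) (M : Matrix m m ℂ) :
    HasSum (fun a => p a * (f a * M).trace.re) (F * M).trace.re := by
  simpa only [Matrix.smul_mul, trace_smul, smul_eq_mul, Complex.re_ofReal_mul] using
    hasSum_re_trace h M

omit [DecidableEq m] in
lemma posSemidef_of_hasSum {f : ι → Matrix m m ℂ} {F : Matrix m m ℂ} (h : HasSum f F)
    (hf : ∀ a, (f a).PosSemidef) : F.PosSemidef := by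
  refine PosSemidef.of_dotProduct_mulVec_nonneg ?_ fun x => ?_
  · have h1 : HasSum (fun a => (f a)ᴴ) Fᴴ := h.matrix_conjTranspose
    simp only [(hf _).1.eq] at h1
    exact h1.unique h
  · have hc : Continuous fun X : Matrix m m ℂ => star x ⬝ᵥ X *ᵥ x :=
      continuous_const.dotProduct (continuous_id.matrix_mulVec continuous_const)
    have h1 := h.map ({ toFun := fun X => star x ⬝ᵥ X *ᵥ x
                        map_zero' := by simp
                        map_add' := fun X Y => by rw [add_mulVec, dotProduct_add] } :
      Matrix m m ℂ →+ ℂ) hc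
    exact h1.nonneg fun a => (hf a).dotProduct_mulVec_nonneg x

variable {A : ι → Matrix m m ℂ} {p q : ι → ℝ} {ρ σ σ' : Matrix m m ℂ}

/-- `Tr[N†σN] = 0` is a sum of nonnegative terms, so each term vanishes. -/
lemma mul_eq_zero_of_hasSum (hp : ∀ a, 0 < p a) (hρ : ρ.PosSemidef)
    (hσ : HasSum (fun a => (p a : ℂ) • (A a * ρ * (A a)ᴴ)) σ) (N : Matrix m m ℂ)
    (hN : σ * N = 0) (a : ι) : ρ * ((A a)ᴴ * N) = 0 := by
  have h1 := hasSum_mul_re_trace hσ (N * Nᴴ)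
  rw [← Matrix.mul_assoc, hN, Matrix.zero_mul, trace_zero, Complex.zero_re] at h1
  have heq : ∀ a, (A a * ρ * (A a)ᴴ * (N * Nᴴ)).trace =
      (((A a)ᴴ * N)ᴴ * ρ * ((A a)ᴴ * N)).trace := by
    intro a
    rw [← Matrix.mul_assoc, trace_mul_comm _ Nᴴ, conjTranspose_mul, conjTranspose_conjTranspose]
    simp only [Matrix.mul_assoc]
  simp only [heq] at h1
  have h2 := (hasSum_zero_iff_of_nonneg fun a => mul_nonneg (hp a).le
    (Complex.nonneg_iff.mp (hρ.conjTranspose_mul_mul_same ((A a)ᴴ * N)).trace_nonneg).1).mp h1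
  exact mul_eq_zero_of_trace_eq_zero hρ
    ((mul_eq_zero.mp (congrFun h2 a)).resolve_left (hp a).ne')

/-- A kernel vector of `σ'` is sent by every `A a` to the kernel of `σ`, and from there by every `(A
a)ᴴ` to the kernel of `ρ`. Completeness of the `(A a)ᴴ * A a` recovers the vector itself. -/
lemma mul_eq_zero_of_recovered (hp : ∀ a, 0 < p a) (hq : ∀ a, 0 < q a) (hρ : ρ.PosSemidef)
    (hσp : σ.PosSemidef) (h1 : HasSum (fun a => (p a : ℂ) • ((A a)ᴴ * A a)) 1)
    (hσ : HasSum (fun a => (p a : ℂ) • (A a * ρ * (A a)ᴴ)) σ)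
    (hσ' : HasSum (fun a => (q a : ℂ) • ((A a)ᴴ * σ * A a)) σ') (N : Matrix m m ℂ)
    (hN : σ' * N = 0) : ρ * N = 0 := by
  have h2 : ∀ a, ρ * ((A a)ᴴ * (A a * N)) = 0 := by
    intro a
    apply mul_eq_zero_of_hasSum hp hρ hσ
    have := mul_eq_zero_of_hasSum (A := fun a => (A a)ᴴ) hq hσp
      (by simpa only [conjTranspose_conjTranspose] using hσ') N hN a
    rwa [conjTranspose_conjTranspose] at this
  have h3 : HasSum (fun a => ρ * ((p a : ℂ) • ((A a)ᴴ * A a)) * N) (ρ * 1 * N) :=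
    (h1.mul_left ρ).mul_right N
  have h4 : (fun a => ρ * ((p a : ℂ) • ((A a)ᴴ * A a)) * N) = fun _ => 0 := by
    ext1 a
    rw [Matrix.mul_smul, Matrix.smul_mul, Matrix.mul_assoc, Matrix.mul_assoc, h2, smul_zero]
  rw [h4, Matrix.mul_one] at h3
  exact h3.unique hasSum_zero

lemma trace_diagConj_mul_log {U W : Matrix m m ℂ} (hU : Uᴴ * U = 1) (hW : Wᴴ * W = 1)
    (r s : m → ℝ) (M : Matrix m m ℂ) :
    (∑ j, ∑ i, r i * Complex.normSq ((Wᴴ * M * U) j i) = (M * diagConj U r * Mᴴ).trace.re) ∧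
    (∑ j, ∑ i, r i * Real.log (r i) * Complex.normSq ((Wᴴ * M * U) j i) =
      (M * (diagConj U r * matLog (diagConj U r)) * Mᴴ).trace.re) ∧
    (∑ j, ∑ i, Real.log (s j) * r i * Complex.normSq ((Wᴴ * M * U) j i) =
      (matLog (diagConj W s) * (M * diagConj U r * Mᴴ)).trace.re) ∧
    (∑ j, ∑ i, s j * Complex.normSq ((Wᴴ * M * U) j i) =
      (diagConj W s * M * Mᴴ).trace.re) := by
  have h1 := trace_diagConj_mul_self W U M (fun _ => 1) r
  have h2 := trace_diagConj_mul_self W U M (fun _ => 1) (fun i => r i * Real.log (r i))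
  have h3 := trace_diagConj_mul_self W U M (fun j => Real.log (s j)) r
  have h4 := trace_diagConj_mul_self W U M s (fun _ => 1)
  rw [diagConj_one hW, Matrix.one_mul] at h1 h2
  rw [diagConj_one hU, Matrix.mul_one] at h4
  unfold matLog
  rw [cfc_diagConj hU, cfc_diagConj hW, diagConj_mul hU, h1, h2, h4, ← Matrix.mul_assoc,
    ← Matrix.mul_assoc, h3]
  simp

/-- The relative entropy of a state and its recovered version is bounded for every channel in
Kraus form; the right-hand side is the relative entropy on system and environment. -/
lemma relEntropy_recovered_le [Countable ι] (hp : ∀ a, 0 < p a) (hq : ∀ a, 0 < q a)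
    (hρ : ρ.PosSemidef) (hσp : σ.PosSemidef) (hσp' : σ'.PosSemidef)
    (h1 : HasSum (fun a => (p a : ℂ) • ((A a)ᴴ * A a)) 1)
    (hσ : HasSum (fun a => (p a : ℂ) • (A a * ρ * (A a)ᴴ)) σ)
    (hσ' : HasSum (fun a => (q a : ℂ) • ((A a)ᴴ * σ * A a)) σ')
    (hρt : ρ.trace.re = 1) (hσt' : σ'.trace.re = 1) {δ : ℝ}
    (hδ : HasSum (fun a => (Real.log (p a) - Real.log (q a)) *
      (p a * (A a * ρ * (A a)ᴴ).trace.re)) δ) :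
    (ρ * matLog ρ).trace.re - (ρ * matLog σ').trace.re ≤
      (ρ * matLog ρ).trace.re - (σ * matLog σ).trace.re + δ := by
  have hker := mul_eq_zero_of_recovered hp hq hρ hσp h1 hσ hσ'
  have hkera := mul_eq_zero_of_hasSum hp hρ hσ
  obtain ⟨U, r, hU, rfl⟩ := exists_diagConj hρ.1
  obtain ⟨W, s, hW, rfl⟩ := exists_diagConj hσp.1
  obtain ⟨W', s', hW', rfl⟩ := exists_diagConj hσp'.1
  have hr := diagConj_nonneg hU hρ
  have hs := diagConj_nonneg hW hσp
  have hs' := diagConj_nonneg hW' hσp'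
  set ρ := diagConj U r
  set σ := diagConj W s
  set σ' := diagConj W' s'
  have h1M : ∀ M N : Matrix m m ℂ,
      HasSum (fun a => p a * (A a * M * (A a * N)ᴴ).trace.re) (M * Nᴴ).trace.re := by
    intro M N
    have := hasSum_mul_re_trace h1 (M * Nᴴ)
    rw [Matrix.one_mul] at this
    convert this using 4 with a
    rw [Matrix.mul_assoc (A a)ᴴ, trace_mul_comm (A a)ᴴ, conjTranspose_mul]
    simp only [Matrix.mul_assoc]
  have hσM : ∀ N : Matrix m m ℂ,
      HasSum (fun a => q a * (σ * (A a * N) * (A a * N)ᴴ).trace.re) (σ' * N * Nᴴ).trace.re := by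
    intro N
    have := hasSum_mul_re_trace hσ' (N * Nᴴ)
    rw [← Matrix.mul_assoc] at this
    convert this using 4 with a
    rw [Matrix.mul_assoc (A a)ᴴ, Matrix.mul_assoc (A a)ᴴ, trace_mul_comm (A a)ᴴ, conjTranspose_mul]
    simp only [Matrix.mul_assoc]
  have htr : HasSum (fun a => p a * (A a * ρ * (A a)ᴴ).trace.re) 1 := by
    have := h1M ρ 1
    simpa only [Matrix.mul_one, conjTranspose_one, hρt] using this
  -- `x` holds the squared overlaps of the eigenvectors of the joint states, whose eigenvalues are
  -- `p a * r i` and `q a * s j`; `y` is its counterpart for `ρ` and `σ'`.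
  set x : ι → m → m → ℝ := fun a j i => Complex.normSq ((Wᴴ * A a * U) j i)
  have hx : ∀ a j i, 0 ≤ x a j i := fun a j i => Complex.normSq_nonneg _
  set y : m → m → ℝ := fun j i => Complex.normSq ((W'ᴴ * U) j i)
  have hy : ∀ j i, 0 ≤ y j i := fun j i => Complex.normSq_nonneg _
  set g : ι → ℝ → ℝ := fun a t =>
    ∑ j, ∑ i, (p a * r i) ^ 2 * x a j i / (q a * s j + t * (p a * r i))
  have hpr : ∀ a i, 0 ≤ p a * r i := fun a i => mul_nonneg (hp a).le (hr i)
  have hqs : ∀ a j, 0 ≤ q a * s j := fun a j => mul_nonneg (hq a).le (hs j)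
  have hg0 : ∀ a t, 0 < t → 0 ≤ g a t := fun a t ht =>
    Finset.sum_nonneg fun j _ => Finset.sum_nonneg fun i _ => div_nonneg
      (mul_nonneg (sq_nonneg _) (hx a j i)) (add_nonneg (hqs a j) (mul_nonneg ht.le (hpr a i)))
  have hgle : ∀ a t, 0 < t → g a t ≤ (p a * (A a * ρ * (A a)ᴴ).trace.re) / t := by
    intro a t ht
    rw [← (trace_diagConj_mul_log hU hW r s (A a)).1, Finset.mul_sum, Finset.sum_div]
    refine Finset.sum_le_sum fun j _ => ?_
    rw [Finset.mul_sum, Finset.sum_div]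
    refine Finset.sum_le_sum fun i _ => ?_
    change (p a * r i) ^ 2 * x a j i / (q a * s j + t * (p a * r i)) ≤ p a * (r i * x a j i) / t
    rcases (hr i).eq_or_lt with h | h
    · rw [← h]
      simp
    · have hpr' := mul_pos (hp a) h
      calc _ ≤ (p a * r i) ^ 2 * x a j i / (t * (p a * r i)) := by
            apply div_le_div_of_nonneg_left (mul_nonneg (sq_nonneg _) (hx a j i)) (by positivity)
            linarith [hqs a j]
        _ = _ := by field_simp
  have hgsum : ∀ t, 0 < t → Summable fun a => g a t := fun t ht =>
    Summable.of_nonneg_of_le (fun a => hg0 a t ht) (fun a => hgle a t ht) (htr.summable.div_const t)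
  -- Monotonicity at fixed `t`: `Z` is optimal for `ρ` and `σ'`, and `A a * Z` is a trial matrix for
  -- each `a`. The three quadratic terms summed over `a` return those of `Z`.
  have hΦ : ∀ t, 0 < t → ∑ j, ∑ i, r i ^ 2 * y j i / (s' j + t * r i) ≤ ∑' a, g a t := by
    intro t ht
    obtain ⟨Z, hZ⟩ := exists_quadratic_eq hU hW' hr hs' ht
    rw [← hZ]
    have hZ1 := h1M ρ Z
    have hZ2 := h1M (Z * ρ) Z
    have hsum := ((hZ1.mul_left 2).sub (hσM Z)).sub (hZ2.mul_left t)
    refine hasSum_le (fun a => ?_) hsum (hgsum t ht).hasSum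
    have := quadratic_le hU hW hr hs (A a) (A a * Z) (hp a).le (hq a).le ht
    rw [← Matrix.mul_assoc (A a) Z]
    exact this
  -- Integration over `[ε, N]`; dominated convergence, with bound of order `1 / ε`, exchanges the
  -- integral with the sum over `a`.
  have hlogsum : ∀ ε N : ℝ, 0 < ε → ε ≤ N →
      ∑ j, ∑ i, y j i * (r i * Real.log ((s' j + N * r i) / (s' j + ε * r i))) ≤
      Real.log N + ((ρ * matLog ρ).trace.re - (σ * matLog σ).trace.re + δ) + 1 / N := by
    intro ε N hε hN
    have hpos : ∀ t ∈ Set.Icc ε N, 0 < t := fun t ht => hε.trans_le ht.1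
    have hterm : ∀ (R S c : ℝ), 0 ≤ R → 0 ≤ S →
        IntervalIntegrable (fun t => R ^ 2 * c / (S + t * R)) MeasureTheory.volume ε N ∧
        ∫ t in ε..N, R ^ 2 * c / (S + t * R) =
          c * (R * Real.log ((S + N * R) / (S + ε * R))) := by
      intro R S c hR hS
      have heq : (fun t => R ^ 2 * c / (S + t * R)) = fun t => c * (R ^ 2 / (S + t * R)) := by
        ext t
        ring
      rw [heq]
      constructor
      · apply ContinuousOn.intervalIntegrable
        rw [Set.uIcc_of_le hN]
        exact continuousOn_const.mul (continuousOn_sq_div_add_mul hR hS hε)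
      · rw [intervalIntegral.integral_const_mul, integral_sq_div_add_mul hR hS hε hN]
    have hdouble : ∀ (R : m → ℝ) (S : m → ℝ) (c : m → m → ℝ), (∀ i, 0 ≤ R i) → (∀ j, 0 ≤ S j) →
        IntervalIntegrable (fun t => ∑ j, ∑ i, R i ^ 2 * c j i / (S j + t * R i))
          MeasureTheory.volume ε N ∧
        ∫ t in ε..N, ∑ j, ∑ i, R i ^ 2 * c j i / (S j + t * R i) =
          ∑ j, ∑ i, c j i * (R i * Real.log ((S j + N * R i) / (S j + ε * R i))) := by
      intro R S c hR hS
      have hi : ∀ j, IntervalIntegrable (fun t => ∑ i, R i ^ 2 * c j i / (S j + t * R i))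
          MeasureTheory.volume ε N := fun j => by
        have := IntervalIntegrable.sum (μ := MeasureTheory.volume) (a := ε) (b := N) Finset.univ
          (f := fun i t => R i ^ 2 * c j i / (S j + t * R i))
          (fun i _ => (hterm _ _ (c j i) (hR i) (hS j)).1)
        simpa only [Finset.sum_fn] using this
      constructor
      · have := IntervalIntegrable.sum (μ := MeasureTheory.volume) (a := ε) (b := N) Finset.univ
          (f := fun j t => ∑ i, R i ^ 2 * c j i / (S j + t * R i)) (fun j _ => hi j)
        simpa only [Finset.sum_fn] using this
      · rw [intervalIntegral.integral_finsetSum fun j _ => hi j]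
        refine Finset.sum_congr rfl fun j _ => ?_
        rw [intervalIntegral.integral_finsetSum fun i _ => (hterm _ _ (c j i) (hR i) (hS j)).1]
        exact Finset.sum_congr rfl fun i _ => (hterm _ _ (c j i) (hR i) (hS j)).2
    have hsmall := hdouble r s' y hr hs'
    have hbig := fun a => hdouble (fun i => p a * r i) (fun j => q a * s j) (x a) (hpr a) (hqs a)
    have hae : ∀ {P : ℝ → Prop}, (∀ t ∈ Set.Icc ε N, P t) →
        ∀ᵐ t ∂MeasureTheory.volume, t ∈ Set.uIoc ε N → P t := fun hP =>
      Eventually.of_forall fun t ht => by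
        rw [Set.uIoc_of_le hN] at ht
        exact hP t ⟨ht.1.le, ht.2⟩
    have hint : HasSum (fun a => ∫ t in ε..N, g a t) (∫ t in ε..N, ∑' a, g a t) := by
      refine intervalIntegral.hasSum_integral_of_dominated_convergence
        (fun a _ => (p a * (A a * ρ * (A a)ᴴ).trace.re) / ε) (fun a => ?_) (fun a => hae ?_)
        (hae ?_) ?_ (hae ?_)
      · have := (hbig a).1.aestronglyMeasurable
        rwa [Set.uIoc_of_le hN]
      · intro t ht
        rw [Real.norm_of_nonneg (hg0 a t (hpos t ht))]
        refine (hgle a t (hpos t ht)).trans ?_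
        refine div_le_div_of_nonneg_left ?_ hε ht.1
        exact mul_nonneg (hp a).le
          (Complex.nonneg_iff.mp (hρ.mul_mul_conjTranspose_same (A a)).trace_nonneg).1
      · exact fun t _ => htr.summable.div_const ε
      · exact intervalIntegrable_const
      · exact fun t ht => (hgsum t (hpos t ht)).hasSum
    have hgint : IntervalIntegrable (fun t => ∑' a, g a t) MeasureTheory.volume ε N := by
      have hm : MeasureTheory.AEStronglyMeasurable (fun t => ∑' a, g a t)
          (MeasureTheory.volume.restrict (Set.uIoc ε N)) := by
        have hm' : ∀ a, Measurable (g a) := fun a => by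
          refine Finset.measurable_fun_sum _ fun j _ => Finset.measurable_fun_sum _ fun i _ => ?_
          fun_prop
        refine aestronglyMeasurable_of_tendsto_ae atTop (f := fun (s : Finset ι) t => ∑ a ∈ s, g a t)
          (fun s => (Finset.measurable_fun_sum _ fun a _ => hm' a).aestronglyMeasurable) ?_
        rw [MeasureTheory.ae_restrict_iff' measurableSet_uIoc]
        exact hae fun t ht => (hgsum t (hpos t ht)).hasSum
      refine (intervalIntegrable_const (c := 1 / ε)).mono_fun hm ?_
      rw [Filter.EventuallyLE, MeasureTheory.ae_restrict_iff' measurableSet_uIoc]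
      refine hae fun t ht => ?_
      have ht0 := hpos t ht
      rw [Real.norm_of_nonneg (tsum_nonneg fun a => hg0 a t ht0), Real.norm_of_nonneg (by positivity)]
      calc _ ≤ 1 / t := hasSum_le (fun a => hgle a t ht0) (hgsum t ht0).hasSum (htr.div_const t)
        _ ≤ 1 / ε := one_div_le_one_div_of_le hε ht.1
    have hle : ∑ j, ∑ i, y j i * (r i * Real.log ((s' j + N * r i) / (s' j + ε * r i))) ≤
        ∫ t in ε..N, ∑' a, g a t := by
      rw [← hsmall.2]
      exact intervalIntegral.integral_mono_on hN hsmall.1 hgint fun t ht => hΦ t (hpos t ht)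
    refine hle.trans ?_
    have hlog1 : HasSum (fun a => p a * (A a * (ρ * matLog ρ) * (A a)ᴴ).trace.re)
        (ρ * matLog ρ).trace.re := by
      simpa only [Matrix.mul_one, conjTranspose_one] using h1M (ρ * matLog ρ) 1
    have hlog2 : HasSum (fun a => p a * (matLog σ * (A a * ρ * (A a)ᴴ)).trace.re)
        (σ * matLog σ).trace.re := by
      simpa only [trace_mul_comm _ (matLog σ)] using hasSum_mul_re_trace hσ (matLog σ)
    have hlog3 : HasSum (fun a => q a * (σ * A a * (A a)ᴴ).trace.re) 1 := by
      simpa only [Matrix.mul_one, conjTranspose_one, hσt'] using hσM 1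
    have hR := ((((htr.mul_left (Real.log N)).add hlog1).sub hlog2).add hδ).add
      (hlog3.div_const N)
    have hval : Real.log N * 1 + (ρ * matLog ρ).trace.re - (σ * matLog σ).trace.re + δ + 1 / N =
      Real.log N + ((ρ * matLog ρ).trace.re - (σ * matLog σ).trace.re + δ) + 1 / N := by ring
    rw [← hval]
    refine hasSum_le (fun a => ?_) hint hR
    change ∫ t in ε..N, ∑ j, ∑ i, (p a * r i) ^ 2 * x a j i / (q a * s j + t * (p a * r i)) ≤ _
    rw [(hbig a).2]
    obtain ⟨e1, e2, e3, e4⟩ := trace_diagConj_mul_log hU hW r s (A a)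
    rw [← e1, ← e2, ← e3, ← e4]
    simp only [Finset.mul_sum, Finset.sum_div, ← Finset.sum_add_distrib, ← Finset.sum_sub_distrib]
    refine Finset.sum_le_sum fun j _ => Finset.sum_le_sum fun i _ => ?_
    refine mul_log_le (hp a) (hq a) (hr i) (hs j) (hx a j i) (fun h => ?_) hε hN
    have := entry_eq_zero_of_mul_eq_zero hU hW (M := A a) (fun N hN => hkera N hN a) (i := i) h
    rcases mul_eq_zero.mp this with h' | h'
    · rw [Complex.ofReal_eq_zero.mp h', zero_mul]
    · simp only [x, h', map_zero, mul_zero]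
  obtain ⟨f1, f2, f3, -⟩ := trace_diagConj_mul_log hU hW' r s' 1
  simp only [Matrix.mul_one, Matrix.one_mul, conjTranspose_one] at f1 f2 f3
  set big := (ρ * matLog ρ).trace.re - (σ * matLog σ).trace.re + δ
  have hlogε : ∀ ε : ℝ, 0 < ε →
      ∑ j, ∑ i, y j i * (r i * (Real.log (r i) - Real.log (s' j + ε * r i))) ≤ big := by
    intro ε hε
    have hN : ∀ N, ε ≤ N →
        ∑ j, ∑ i, y j i * (r i * (Real.log (r i) - Real.log (s' j + ε * r i))) ≤ big + 1 / N := by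
      intro N hN
      have hN0 := hε.trans_le hN
      have h := hlogsum ε N hε hN
      -- As `Tr ρ = 1`, the divergent `log N` occurs with coefficient one on both sides and cancels.
      have h' : Real.log N + ∑ j, ∑ i, y j i * (r i * (Real.log (r i) - Real.log (s' j + ε * r i)))
          ≤ ∑ j, ∑ i, y j i * (r i * Real.log ((s' j + N * r i) / (s' j + ε * r i))) := by
        have : Real.log N = ∑ j, ∑ i, Real.log N * (r i * y j i) := by
          simp only [← Finset.mul_sum]
          rw [f1, hρt, mul_one]
        rw [this]
        simp only [← Finset.sum_add_distrib]
        refine Finset.sum_le_sum fun j _ => Finset.sum_le_sum fun i _ => ?_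
        rcases (hr i).eq_or_lt with h0 | h0
        · rw [← h0]
          simp
        have hε' : 0 < s' j + ε * r i := add_pos_of_nonneg_of_pos (hs' j) (by positivity)
        have hlog : Real.log N + Real.log (r i) - Real.log (s' j + ε * r i) ≤
            Real.log ((s' j + N * r i) / (s' j + ε * r i)) := by
          rw [← Real.log_mul hN0.ne' h0.ne', ← Real.log_div (by positivity) hε'.ne']
          apply Real.log_le_log (by positivity)
          gcongr
          linarith [hs' j]
        calc _ = y j i * (r i * (Real.log N + Real.log (r i) - Real.log (s' j + ε * r i))) := by
              ring
          _ ≤ _ := mul_le_mul_of_nonneg_left (mul_le_mul_of_nonneg_left hlog h0.le) (hy j i)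
      linarith
    have hlim : Tendsto (fun N : ℝ => big + 1 / N) atTop (𝓝 (big + 0)) := by
      simpa only [one_div] using tendsto_const_nhds.add tendsto_inv_atTop_zero
    rw [add_zero] at hlim
    exact ge_of_tendsto hlim (eventually_atTop.mpr ⟨ε, hN⟩)
  have hD : (ρ * matLog ρ).trace.re - (ρ * matLog σ').trace.re =
      ∑ j, ∑ i, y j i * (r i * (Real.log (r i) - Real.log (s' j))) := by
    rw [trace_mul_comm ρ (matLog σ'), ← f2, ← f3]
    simp only [← Finset.sum_sub_distrib]
    refine Finset.sum_congr rfl fun j _ => Finset.sum_congr rfl fun i _ => ?_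
    change _ * y j i - _ * y j i = _
    ring
  rw [hD]
  have hlim : Tendsto (fun ε : ℝ =>
      ∑ j, ∑ i, y j i * (r i * (Real.log (r i) - Real.log (s' j + ε * r i)))) (𝓝[>] 0)
      (𝓝 (∑ j, ∑ i, y j i * (r i * (Real.log (r i) - Real.log (s' j))))) := by
    refine tendsto_finsetSum _ fun j _ => tendsto_finsetSum _ fun i _ => ?_
    -- Here the logarithm may diverge as `ε → 0`, but the support condition makes its coefficient
    -- zero.
    by_cases h0 : s' j = 0
    · have := entry_eq_zero_of_mul_eq_zero hU hW' (M := 1)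
        (by simpa only [conjTranspose_one, Matrix.one_mul] using hker) (i := i) h0
      rw [Matrix.mul_one] at this
      have hz : r i = 0 ∨ y j i = 0 := by
        rcases mul_eq_zero.mp this with h' | h'
        · exact Or.inl (Complex.ofReal_eq_zero.mp h')
        · exact Or.inr (by simp only [y, h', map_zero])
      rcases hz with hz | hz <;> simp [hz]
    · have : ContinuousAt (fun ε : ℝ => y j i * (r i * (Real.log (r i) -
          Real.log (s' j + ε * r i)))) 0 := by
        have hc : ContinuousAt (fun ε : ℝ => Real.log (s' j + ε * r i)) 0 :=
          ContinuousAt.log (by fun_prop) (by simpa using h0)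
        exact continuousAt_const.mul (continuousAt_const.mul (continuousAt_const.sub hc))
      have h2 := this.tendsto.mono_left (nhdsWithin_le_nhds (s := Set.Ioi 0))
      simpa using h2
  refine le_of_tendsto hlim ?_
  filter_upwards [self_mem_nhdsWithin] with ε hε
  exact hlogε ε hε

end Kraus

/-! ### Kraus representation of thermal operations by bath blocks. -/

section Blocks

lemma matrix_hasSum_iff {m ι : Type*} {f : ι → Matrix m m ℂ} {F : Matrix m m ℂ} :
    HasSum f F ↔ ∀ s t, HasSum (fun a => f a s t) (F s t) :=
  Pi.hasSum.trans (forall_congr' fun _ => Pi.hasSum)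

variable {n κ K : Type*} [Fintype n] [DecidableEq n]
  [NormedAddCommGroup K] [InnerProductSpace ℂ K] [CompleteSpace K]

/-- The operator `⟨b_l| V |b_k⟩` on the system, indexed by `a = (k, l)`. -/
def bathBlock (b : HilbertBasis κ ℂ K) (V : Matrix n n (K →L[ℂ] K)) (a : κ × κ) : Matrix n n ℂ :=
  Matrix.of fun s t => ⟪b a.2, V s t (b a.1)⟫_ℂ

/-- The occupation probabilities of the bath levels in the thermal state. -/
def bathWeight (E : κ → ℝ) (β : ℝ) (k : κ) : ℝ := Real.exp (-β * E k) / bathPartition E β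

variable {b : HilbertBasis κ ℂ K} {E : κ → ℝ} {β : ℝ} {V : Matrix n n (K →L[ℂ] K)}

omit [Fintype n] [DecidableEq n] in
lemma bathBlock_star (k l : κ) :
    bathBlock b (star V) (k, l) = (bathBlock b V (l, k))ᴴ := by
  ext s t
  simp only [bathBlock, of_apply, conjTranspose_apply, star_apply, ContinuousLinearMap.star_eq_adjoint,
    ContinuousLinearMap.adjoint_inner_right]
  rw [RCLike.star_def, inner_conj_symm]

lemma bathPartition_pos [Nonempty κ] (hE : Summable fun i => Real.exp (-β * E i)) :
    0 < bathPartition E β :=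
  hE.tsum_pos (fun _ => (Real.exp_pos _).le) (Classical.arbitrary κ) (Real.exp_pos _)

lemma bathWeight_pos (hE : Summable fun i => Real.exp (-β * E i)) (k : κ) :
    0 < bathWeight E β k :=
  have : Nonempty κ := ⟨k⟩
  div_pos (Real.exp_pos _) (bathPartition_pos hE)

lemma hasSum_bathWeight [Nonempty κ] (hE : Summable fun i => Real.exp (-β * E i)) :
    HasSum (bathWeight E β) 1 := by
  have := hE.hasSum.div_const (bathPartition E β)
  rwa [show (∑' i, Real.exp (-β * E i)) / bathPartition E β = 1 from
    div_self (bathPartition_pos hE).ne'] at this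

lemma log_bathWeight (hE : Summable fun i => Real.exp (-β * E i)) (k : κ) :
    Real.log (bathWeight E β k) = -β * E k - Real.log (bathPartition E β) := by
  have : Nonempty κ := ⟨k⟩
  rw [bathWeight, Real.log_div (Real.exp_pos _).ne' (bathPartition_pos hE).ne', Real.log_exp]

/-- Matrix elements of an operator in the form of its action on the thermal state. -/
lemma hasSum_inner_bathGibbs (hE : Summable fun i => Real.exp (-β * E i)) (x y : K) :
    HasSum (fun k => (bathWeight E β k : ℂ) * (⟪x, b k⟫_ℂ * ⟪b k, y⟫_ℂ))
      ⟪x, bathGibbs b E β y⟫_ℂ := by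
  have hs : Summable fun k => ((bathWeight E β k : ℝ) : ℂ) •
      InnerProductSpace.rankOne ℂ (b k) (b k) := by
    apply Summable.of_norm
    refine (hE.div_const (bathPartition E β)).congr fun k => ?_
    rw [norm_smul, Complex.norm_real, Real.norm_of_nonneg (bathWeight_pos hE k).le,
      InnerProductSpace.norm_rankOne, b.orthonormal.1 k, mul_one, mul_one]
    rfl
  have h1 := (hs.hasSum.mapL (ContinuousLinearMap.apply ℂ K y)).mapL (innerSL ℂ x)
  refine HasSum.congr_fun h1 fun k => ?_
  change _ = ⟪x, ((bathWeight E β k : ℝ) : ℂ) • (⟪b k, y⟫_ℂ • b k)⟫_ℂ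
  rw [inner_smul_right, inner_smul_right]
  ring

lemma sum_conj_mul_eq (hV : star V * V = 1) (x y : K) (s t : n) :
    ∑ u, ⟪V u s x, V u t y⟫_ℂ = if s = t then ⟪x, y⟫_ℂ else 0 := by
  have h1 := congrFun (congrFun hV s) t
  rw [mul_apply, one_apply] at h1
  have h2 := congrArg (fun B : K →L[ℂ] K => ⟪x, B y⟫_ℂ) h1
  simp only [_root_.sum_apply, inner_sum, star_apply] at h2
  have h3 : ∀ u, ⟪x, (star (V u s) * V u t) y⟫_ℂ = ⟪V u s x, V u t y⟫_ℂ := by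
    intro u
    rw [mul_apply_eq_comp, ContinuousLinearMap.star_eq_adjoint,
      ContinuousLinearMap.adjoint_inner_right]
  simp only [h3] at h2
  rw [h2]
  split_ifs <;> simp

/-- Completeness of the blocks with a fixed initial state of the bath. -/
lemma hasSum_bathBlock (hV : star V * V = 1) (k : κ) :
    HasSum (fun l => (bathBlock b V (k, l))ᴴ * bathBlock b V (k, l)) 1 := by
  refine matrix_hasSum_iff.mpr fun s t => ?_
  have h1 : HasSum (fun l => ∑ u, ⟪V u s (b k), b l⟫_ℂ * ⟪b l, V u t (b k)⟫_ℂ)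
      (∑ u, ⟪V u s (b k), V u t (b k)⟫_ℂ) :=
    hasSum_sum fun u _ => b.hasSum_inner_mul_inner _ _
  rw [sum_conj_mul_eq hV, inner_self_eq_norm_sq_to_K, b.orthonormal.1 k] at h1
  convert h1 using 1
  · ext l
    rw [mul_apply]
    refine Finset.sum_congr rfl fun u _ => ?_
    simp only [bathBlock, conjTranspose_apply, of_apply]
    rw [RCLike.star_def, inner_conj_symm]
  · rw [one_apply]
    simp

/-- By Parseval and unitarity the squared entries sum over `l` to at most `1`, and the thermal
weights are summable over `k`. Absolute summability over pairs permits the exchange of the trace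
over `l` with the thermal average over `k`. -/
lemma summable_bathBlock_mul (hE : Summable fun i => Real.exp (-β * E i))
    (hV : star V * V = 1) (s u t v : n) :
    Summable fun a : κ × κ => (bathWeight E β a.1 : ℂ) *
      (bathBlock b V a s u * star (bathBlock b V a t v)) := by
  have hre : ∀ x : K, (⟪x, x⟫_ℂ).re = ‖x‖ ^ 2 := fun x => inner_self_eq_norm_sq (𝕜 := ℂ) x
  have hdiag : ∀ k s u, HasSum (fun l => Complex.normSq (bathBlock b V (k, l) s u))
      (‖V s u (b k)‖ ^ 2) ∧ ‖V s u (b k)‖ ^ 2 ≤ 1 := by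
    intro k s u
    constructor
    · have := b.hasSum_inner_mul_inner (V s u (b k)) (V s u (b k))
      have h2 := Complex.hasSum_re this
      rw [hre] at h2
      refine HasSum.congr_fun h2 fun l => ?_
      have : ⟪V s u (b k), b l⟫_ℂ = star (bathBlock b V (k, l) s u) := by
        simp only [bathBlock, of_apply]
        rw [RCLike.star_def, inner_conj_symm]
      rw [this]
      change _ = (star _ * bathBlock b V (k, l) s u).re
      rw [mul_comm, Complex.star_def, Complex.mul_conj, Complex.ofReal_re]
    · have h1 := sum_conj_mul_eq hV (b k) (b k) u u
      have h2 : ∑ w, ‖V w u (b k)‖ ^ 2 = 1 := by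
        have h3 := congrArg Complex.re h1
        rw [Complex.re_sum, if_pos rfl, hre, b.orthonormal.1 k, one_pow] at h3
        simpa only [hre] using h3
      rw [← h2]
      exact Finset.single_le_sum (f := fun w => ‖V w u (b k)‖ ^ 2) (fun w _ => sq_nonneg _)
        (Finset.mem_univ s)
  have hsq : ∀ s u, Summable fun a : κ × κ =>
      bathWeight E β a.1 * Complex.normSq (bathBlock b V a s u) := by
    intro s u
    have hfib : ∀ k, Summable fun l =>
        bathWeight E β k * Complex.normSq (bathBlock b V (k, l) s u) :=
      fun k => (hdiag k s u).1.summable.mul_left (bathWeight E β k)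
    refine (summable_prod_of_nonneg
      (fun a => mul_nonneg (bathWeight_pos hE a.1).le (Complex.normSq_nonneg _))).mpr ⟨hfib, ?_⟩
    refine Summable.of_nonneg_of_le (fun k => tsum_nonneg fun l =>
      mul_nonneg (bathWeight_pos hE k).le (Complex.normSq_nonneg _)) (fun k => ?_)
      (hE.div_const (bathPartition E β))
    refine (((hdiag k s u).1.mul_left (bathWeight E β k)).tsum_eq).trans_le ?_
    exact mul_le_of_le_one_right (bathWeight_pos hE k).le (hdiag k s u).2
  refine Summable.of_norm_bounded ((hsq s u).add (hsq t v)) fun a => ?_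
  rw [norm_mul, norm_mul, norm_star, Complex.norm_real,
    Real.norm_of_nonneg (bathWeight_pos hE a.1).le, ← mul_add, Complex.normSq_eq_norm_sq,
    Complex.normSq_eq_norm_sq]
  refine mul_le_mul_of_nonneg_left ?_ (bathWeight_pos hE a.1).le
  nlinarith [sq_nonneg (‖bathBlock b V a s u‖ - ‖bathBlock b V a t v‖),
    sq_nonneg ‖bathBlock b V a s u‖, sq_nonneg ‖bathBlock b V a t v‖]

lemma hasSum_weight_bathBlock (hE : Summable fun i => Real.exp (-β * E i)) [Nonempty κ]
    (hV : star V * V = 1) :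
    HasSum (fun a : κ × κ => (bathWeight E β a.1 : ℂ) • ((bathBlock b V a)ᴴ * bathBlock b V a))
      1 := by
  have hsum : Summable fun a : κ × κ =>
      (bathWeight E β a.1 : ℂ) • ((bathBlock b V a)ᴴ * bathBlock b V a) := by
    refine Pi.summable.mpr fun s => Pi.summable.mpr fun t => ?_
    have : Summable fun a : κ × κ => ∑ u, (bathWeight E β a.1 : ℂ) *
        (bathBlock b V a u t * star (bathBlock b V a u s)) :=
      summable_sum fun u _ => summable_bathBlock_mul hE hV u t u s
    refine this.congr fun a => ?_
    rw [Matrix.smul_apply, mul_apply, smul_eq_mul, Finset.mul_sum]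
    refine Finset.sum_congr rfl fun u _ => ?_
    rw [conjTranspose_apply]
    ring
  have h1 := hsum.hasSum.prod_fiberwise (g := fun k => (bathWeight E β k : ℂ) • 1)
    fun k => (hasSum_bathBlock hV k).const_smul _
  have h2 : HasSum (fun k => (bathWeight E β k : ℂ) • (1 : Matrix n n ℂ)) 1 := by
    have := (Complex.hasSum_ofReal.mpr (hasSum_bathWeight hE)).smul_const (1 : Matrix n n ℂ)
    simpa only [Complex.ofReal_one, one_smul] using this
  rw [h2.unique h1]
  exact hsum.hasSum

/-- The Kraus representation of a thermal operation. -/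
lemma hasSum_thermalMap (hE : Summable fun i => Real.exp (-β * E i)) (hV : star V * V = 1)
    (X : Matrix n n ℂ) :
    HasSum (fun a : κ × κ => (bathWeight E β a.1 : ℂ) •
      (bathBlock b V a * X * (bathBlock b V a)ᴴ)) (thermalMap b E β V X) := by
  refine matrix_hasSum_iff.mpr fun s t => ?_
  have hentry : ∀ a : κ × κ, ((bathWeight E β a.1 : ℂ) •
      (bathBlock b V a * X * (bathBlock b V a)ᴴ)) s t = ∑ v, ∑ u, X u v *
      ((bathWeight E β a.1 : ℂ) * (bathBlock b V a s u * star (bathBlock b V a t v))) := by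
    intro a
    rw [Matrix.smul_apply, mul_apply, smul_eq_mul, Finset.mul_sum]
    refine Finset.sum_congr rfl fun v _ => ?_
    rw [mul_apply, Finset.sum_mul, Finset.mul_sum, conjTranspose_apply]
    exact Finset.sum_congr rfl fun u _ => by ring
  have hsum : Summable fun a : κ × κ => ((bathWeight E β a.1 : ℂ) •
      (bathBlock b V a * X * (bathBlock b V a)ᴴ)) s t := by
    simp only [hentry]
    exact summable_sum fun v _ => summable_sum fun u _ =>
      (summable_bathBlock_mul hE hV s u t v).mul_left _
  have hfib : ∀ l, HasSum (fun k => ((bathWeight E β k : ℂ) •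
      (bathBlock b V (k, l) * X * (bathBlock b V (k, l))ᴴ)) s t)
      ⟪b l, (V * tensorOp X (bathGibbs b E β) * star V) s t (b l)⟫_ℂ := by
    intro l
    have hval : ⟪b l, (V * tensorOp X (bathGibbs b E β) * star V) s t (b l)⟫_ℂ =
        ∑ v, ∑ u, X u v * ⟪ContinuousLinearMap.adjoint (V s u) (b l),
          bathGibbs b E β (ContinuousLinearMap.adjoint (V t v) (b l))⟫_ℂ := by
      rw [mul_apply, _root_.sum_apply, inner_sum]
      refine Finset.sum_congr rfl fun v _ => ?_
      rw [mul_apply, Finset.sum_mul, _root_.sum_apply, inner_sum]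
      refine Finset.sum_congr rfl fun u _ => ?_
      rw [star_apply, ContinuousLinearMap.star_eq_adjoint, ContinuousLinearMap.adjoint_inner_left]
      simp only [tensorOp, of_apply, mul_apply_eq_comp, _root_.smul_apply,
        map_smul, inner_smul_right]
    rw [hval]
    refine HasSum.congr_fun ?_ fun k => hentry (k, l)
    refine hasSum_sum fun v _ => hasSum_sum fun u _ => ?_
    refine HasSum.congr_fun ((hasSum_inner_bathGibbs (b := b) hE
      (ContinuousLinearMap.adjoint (V s u) (b l))
      (ContinuousLinearMap.adjoint (V t v) (b l))).mul_left (X u v)) fun k => ?_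
    rw [ContinuousLinearMap.adjoint_inner_left, ContinuousLinearMap.adjoint_inner_right]
    simp only [bathBlock, of_apply]
    rw [RCLike.star_def, inner_conj_symm]
  -- The partial trace sums over the final level `l` last, so the pair is swapped to make `l` the
  -- outer index.
  have h1 : HasSum (fun a : κ × κ => ((bathWeight E β a.2 : ℂ) •
      (bathBlock b V a.swap * X * (bathBlock b V a.swap)ᴴ)) s t) _ :=
    (Equiv.prodComm κ κ).hasSum_iff.mpr hsum.hasSum
  have h2 := (h1.prod_fiberwise hfib).tsum_eq
  have h3 : thermalMap b E β V X s t =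
      ∑' l, ⟪b l, (V * tensorOp X (bathGibbs b E β) * star V) s t (b l)⟫_ℂ := rfl
  rw [h3, h2]
  exact hsum.hasSum

/-- The block `(k, l)` of `star V` is the adjoint of the block `(l, k)` of `V`; reindexing moves the
weight to the second component. -/
lemma hasSum_recoveryMap (hE : Summable fun i => Real.exp (-β * E i)) (hV : V * star V = 1)
    (X : Matrix n n ℂ) :
    HasSum (fun a : κ × κ => (bathWeight E β a.2 : ℂ) •
      ((bathBlock b V a)ᴴ * X * bathBlock b V a)) (recoveryMap b E β V X) := by
  have h1 := hasSum_thermalMap (b := b) (V := star V) hE (by rwa [star_star]) X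
  have h2 : thermalMap b E β (star V) X = recoveryMap b E β V X := by
    rw [thermalMap, recoveryMap, star_star]
  rw [h2, ← (Equiv.prodComm κ κ).hasSum_iff] at h1
  convert h1 using 1
  ext1 a
  obtain ⟨k, l⟩ := a
  simp only [Function.comp_apply, Equiv.prodComm_apply, Prod.swap_prod_mk, bathBlock_star,
    conjTranspose_conjTranspose]

lemma thermalMap_posSemidef (hE : Summable fun i => Real.exp (-β * E i)) (hV : star V * V = 1)
    {X : Matrix n n ℂ} (hX : X.PosSemidef) : (thermalMap b E β V X).PosSemidef :=
  posSemidef_of_hasSum (hasSum_thermalMap hE hV X) fun a =>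
    (hX.mul_mul_conjTranspose_same _).smul
      (Complex.zero_le_real.mpr (bathWeight_pos hE a.1).le)

lemma thermalMap_trace [Nonempty κ] (hE : Summable fun i => Real.exp (-β * E i))
    (hV : star V * V = 1) (X : Matrix n n ℂ) :
    (thermalMap b E β V X).trace.re = X.trace.re := by
  have h1 := hasSum_mul_re_trace (hasSum_thermalMap (b := b) hE hV X) 1
  have h2 := hasSum_mul_re_trace (hasSum_weight_bathBlock (b := b) hE hV) X
  rw [Matrix.one_mul] at h2
  rw [Matrix.mul_one] at h1
  refine h1.unique ?_
  convert h2 using 4 with a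
  rw [Matrix.mul_one, trace_mul_comm, ← Matrix.mul_assoc]

lemma thermalMap_isDensity [Nonempty κ] (hE : Summable fun i => Real.exp (-β * E i))
    (hV : star V * V = 1) {X : Matrix n n ℂ} (hX : IsDensity X) :
    IsDensity (thermalMap b E β V X) := by
  have h := thermalMap_posSemidef (b := b) hE hV hX.1
  refine ⟨h, Complex.ext ?_ ?_⟩
  · rw [thermalMap_trace hE hV, hX.2]
  · exact (Complex.nonneg_iff.mp h.trace_nonneg).2.symm

end Blocks

/-! ### Energy conservation. -/

section Energy

variable {n κ K : Type*} [Fintype n] [DecidableEq n]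
  [NormedAddCommGroup K] [InnerProductSpace ℂ K] [CompleteSpace K]
  {b : HilbertBasis κ ℂ K} {E : κ → ℝ} {β : ℝ} {V : Matrix n n (K →L[ℂ] K)} {H : Matrix n n ℂ}

omit [CompleteSpace K] in
/-- Product vectors `e_t ⊗ b_k` are in the domain of the total Hamiltonian. -/
lemma totalEnergyGraph_single (t : n) (k : κ) :
    TotalEnergyGraph b E H (Pi.single t (b k))
      (fun s => (H s t + if s = t then (E k : ℂ) else 0) • b k) := by
  classical
  intro s l
  have hb := orthonormal_iff_ite.mp b.orthonormal l k
  have h1 : ∀ u, ⟪b l, (Pi.single t (b k) : n → K) u⟫_ℂ =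
      if u = t then (if l = k then 1 else 0) else 0 := by
    intro u
    by_cases hu : u = t
    · subst hu
      simp [hb]
    · simp [hu]
  simp only [h1, inner_smul_right, hb]
  by_cases hk : l = k
  · subst hk
    by_cases hs : s = t <;> simp [hs]
  · simp [hk]

omit [CompleteSpace K] in
lemma applyOp_single (t : n) (x : K) (s : n) : applyOp V (Pi.single t x) s = V s t x := by
  unfold applyOp
  rw [Finset.sum_eq_single t]
  · simp
  · intro u _ hu
    simp [hu]
  · simp

omit [CompleteSpace K] in
-- The commutation relation between `e_t ⊗ b_k` and `e_s ⊗ b_l`: the possibly unbounded `H_B` enters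
-- only through `E l - E k`.
lemma energy_commutator (hV : CommutesWithEnergy b E H V) (k l : κ) :
    ((E l - E k : ℝ) : ℂ) • bathBlock b V (k, l) =
      bathBlock b V (k, l) * H - H * bathBlock b V (k, l) := by
  ext s t
  have h := hV _ _ (totalEnergyGraph_single t k) s l
  simp only [applyOp_single] at h
  unfold applyOp at h
  simp only [inner_sum, map_smul, inner_smul_right, add_mul, Finset.sum_add_distrib, ite_mul,
    zero_mul, Finset.sum_ite_eq', Finset.mem_univ, if_true] at h
  rw [Matrix.smul_apply, Matrix.sub_apply, mul_apply, mul_apply, smul_eq_mul]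
  simp only [bathBlock, of_apply]
  have h2 : ∑ u, ⟪b l, V s u (b k)⟫_ℂ * H u t = ∑ u, H u t * ⟪b l, V s u (b k)⟫_ℂ :=
    Finset.sum_congr rfl fun u _ => mul_comm _ _
  rw [h2]
  push_cast
  linear_combination -h

/-- The heat absorbed by the bath is the energy lost by the system. -/
lemma hasSum_heat [Nonempty κ] (hE : Summable fun i => Real.exp (-β * E i))
    (hV : star V * V = 1) (hVE : CommutesWithEnergy b E H V) (ρ : Matrix n n ℂ) :
    HasSum (fun a : κ × κ => (Real.log (bathWeight E β a.1) - Real.log (bathWeight E β a.2)) *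
      (bathWeight E β a.1 * (bathBlock b V a * ρ * (bathBlock b V a)ᴴ).trace.re))
      (β * ((H * ρ).trace.re - (H * thermalMap b E β V ρ).trace.re)) := by
  have h1 := hasSum_mul_re_trace (hasSum_weight_bathBlock (b := b) hE hV) (H * ρ)
  have h2 := hasSum_mul_re_trace (hasSum_thermalMap (b := b) hE hV ρ) H
  rw [Matrix.one_mul] at h1
  rw [trace_mul_comm _ H] at h2
  refine HasSum.congr_fun ((h1.sub h2).mul_left β) fun ⟨k, l⟩ => ?_
  rw [log_bathWeight hE, log_bathWeight hE]
  set B := bathBlock b V (k, l)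
  -- The logarithms of the weights differ by `β (E l - E k)`, as `log Z_B` cancels; the commutator
  -- relation is then traced against `ρ * Bᴴ`.
  have h3 : (E l - E k) * (B * ρ * Bᴴ).trace.re = (Bᴴ * B * (H * ρ)).trace.re -
      (B * ρ * Bᴴ * H).trace.re := by
    have h4 := congrArg (fun M => (M * (ρ * Bᴴ)).trace.re) (energy_commutator hVE k l)
    simp only [Matrix.smul_mul, trace_smul, smul_eq_mul, Complex.re_ofReal_mul, Matrix.sub_mul,
      trace_sub, Complex.sub_re] at h4
    rw [Matrix.mul_assoc B ρ, h4, trace_mul_comm (B * (ρ * Bᴴ)) H, Matrix.mul_assoc Bᴴ B,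
      trace_mul_comm Bᴴ]
    simp only [Matrix.mul_assoc]
    rfl
  linear_combination (β * bathWeight E β k) * h3

omit [DecidableEq n] [CompleteSpace K] in
lemma hasSum_sum_inner_mul_inner {ψ φ : n → K} :
    HasSum (fun l => ∑ s, ⟪ψ s, b l⟫_ℂ * ⟪b l, φ s⟫_ℂ) (∑ s, ⟪ψ s, φ s⟫_ℂ) :=
  hasSum_sum fun _ _ => b.hasSum_inner_mul_inner _ _

omit [DecidableEq n] [CompleteSpace K] in
/-- The total Hamiltonian is symmetric. -/
lemma totalEnergyGraph_symm (hH : H.IsHermitian) {ψ φ ψ' φ' : n → K}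
    (h : TotalEnergyGraph b E H ψ φ) (h' : TotalEnergyGraph b E H ψ' φ') :
    ∑ s, ⟪ψ' s, φ s⟫_ℂ = ∑ s, ⟪φ' s, ψ s⟫_ℂ := by
  refine (hasSum_sum_inner_mul_inner (b := b)).unique ?_
  convert hasSum_sum_inner_mul_inner (b := b) (ψ := φ') (φ := ψ) using 1
  ext1 l
  have hφ' : ∀ s, ⟪φ' s, b l⟫_ℂ = ∑ t, H t s * ⟪ψ' t, b l⟫_ℂ + E l * ⟪ψ' s, b l⟫_ℂ := by
    intro s
    rw [← inner_conj_symm, h' s l]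
    simp only [map_add, map_sum, map_mul, inner_conj_symm, Complex.conj_ofReal]
    congr 1
    refine Finset.sum_congr rfl fun t _ => ?_
    congr 1
    exact congrFun (congrFun hH t) s
  have hφ : ∀ s, ⟪b l, φ s⟫_ℂ = _ := fun s => h s l
  simp only [hφ, hφ', mul_add, add_mul, Finset.sum_add_distrib, Finset.mul_sum, Finset.sum_mul]
  congr 1
  · rw [Finset.sum_comm]
    exact Finset.sum_congr rfl fun s _ => Finset.sum_congr rfl fun t _ => by ring
  · exact Finset.sum_congr rfl fun s _ => by ring

omit [DecidableEq n] in
lemma sum_inner_applyOp_star (V : Matrix n n (K →L[ℂ] K)) (ψ φ : n → K) :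
    ∑ s, ⟪ψ s, applyOp (star V) φ s⟫_ℂ = ∑ s, ⟪applyOp V ψ s, φ s⟫_ℂ := by
  unfold applyOp
  simp only [inner_sum, sum_inner, star_apply, ContinuousLinearMap.star_eq_adjoint,
    ContinuousLinearMap.adjoint_inner_right]
  exact Finset.sum_comm

/-- The adjoint of a bounded operator commuting with the total energy commutes with it. -/
lemma commutesWithEnergy_star (hH : H.IsHermitian) (hV : CommutesWithEnergy b E H V) :
    CommutesWithEnergy b E H (star V) := by
  intro ψ φ h s k
  -- The graph condition consists of inner products with product vectors. These lie in the domain,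
  -- so symmetry moves the Hamiltonian and `V` onto them.
  have h0 := totalEnergyGraph_single (b := b) (E := E) (H := H) s k
  have h1 := totalEnergyGraph_symm hH h (hV _ _ h0)
  rw [← sum_inner_applyOp_star, ← sum_inner_applyOp_star] at h1
  have hL : ∑ u, ⟪(Pi.single s (b k) : n → K) u, applyOp (star V) φ u⟫_ℂ =
      ⟪b k, applyOp (star V) φ s⟫_ℂ := by
    rw [Finset.sum_eq_single s]
    · simp
    · intro u _ hu
      simp [hu]
    · simp
  rw [hL] at h1
  rw [h1]
  simp only [inner_smul_left, map_add, add_mul, Finset.sum_add_distrib]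
  congr 1
  · refine Finset.sum_congr rfl fun u _ => ?_
    congr 1
    exact congrFun (congrFun hH s) u
  · rw [Finset.sum_eq_single s]
    · simp
    · intro u _ hu
      simp [hu]
    · simp

lemma recoveryMap_isThermalOperation (hH : H.IsHermitian)
    (hV : IsEnergyConservingUnitary b E H V) :
    IsThermalOperation b E β H (recoveryMap b E β V) := by
  refine ⟨star V, ⟨Unitary.star_mem hV.1, commutesWithEnergy_star hH hV.2⟩, fun X => ?_⟩
  rw [thermalMap, recoveryMap, star_star]

end Energy

/-! ### The fidelity lower bound on the relative entropy. -/

section Fidelity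

variable {m : Type*} [Fintype m] [DecidableEq m]

lemma trace_diagConj {U : Matrix m m ℂ} (hU : Uᴴ * U = 1) (d : m → ℝ) :
    (diagConj U d).trace = ((∑ i, d i : ℝ) : ℂ) := by
  unfold diagConj
  rw [trace_mul_comm, ← Matrix.mul_assoc, hU, Matrix.one_mul, trace_diagonal]
  push_cast
  rfl

lemma matSqrt_isHermitian {A : Matrix m m ℂ} (hA : A.IsHermitian) : (matSqrt A).IsHermitian := by
  obtain ⟨U, d, hU, rfl⟩ := exists_diagConj hA
  rw [matSqrt, cfc_diagConj hU]
  exact diagConj_isHermitian _ _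

lemma matSqrt_mul_self {A : Matrix m m ℂ} (hA : A.PosSemidef) : matSqrt A * matSqrt A = A := by
  obtain ⟨U, d, hU, rfl⟩ := exists_diagConj hA.1
  rw [matSqrt, cfc_diagConj hU, diagConj_mul hU]
  congr 1
  ext i
  exact Real.mul_self_sqrt (diagConj_nonneg hU hA i)

/-- The trace is bounded by the trace norm. -/
lemma norm_trace_le (M : Matrix m m ℂ) : ‖M.trace‖ ≤ (matSqrt (Mᴴ * M)).trace.re := by
  have hP : (Mᴴ * M).PosSemidef := posSemidef_conjTranspose_mul_self M
  obtain ⟨X, d, hX, hXd⟩ := exists_diagConj hP.1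
  rw [hXd, matSqrt, cfc_diagConj hX, trace_diagConj hX, Complex.ofReal_re]
  -- In an eigenbasis of `Mᴴ * M`, column `i` of `M` has squared norm `d i`, which bounds its
  -- diagonal entry.
  have h1 : M.trace = (Xᴴ * M * X).trace := by
    rw [trace_mul_comm, ← Matrix.mul_assoc, mul_eq_one_comm.mp hX, Matrix.one_mul]
  rw [h1, trace]
  refine (norm_sum_le _ _).trans (Finset.sum_le_sum fun i _ => ?_)
  apply Real.le_sqrt_of_sq_le
  have h2 : (Xᴴ * M * X)ᴴ * (Xᴴ * M * X) = diagonal (fun i => (d i : ℂ)) := by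
    rw [← conjTranspose_mul_diagConj_mul hX, ← hXd]
    simp only [conjTranspose_mul, conjTranspose_conjTranspose]
    calc _ = Xᴴ * Mᴴ * (X * Xᴴ) * (M * X) := by simp only [Matrix.mul_assoc]
      _ = _ := by
        rw [mul_eq_one_comm.mp hX, Matrix.mul_one]
        simp only [Matrix.mul_assoc]
  have h3 := congrFun (congrFun h2 i) i
  rw [mul_apply, diagonal_apply_eq] at h3
  have h4 : ∑ j, ‖(Xᴴ * M * X) j i‖ ^ 2 = d i := by
    rw [← Complex.ofReal_re (d i), ← h3, Complex.re_sum]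
    refine Finset.sum_congr rfl fun j _ => ?_
    rw [conjTranspose_apply, mul_comm, Complex.star_def, Complex.mul_conj, Complex.ofReal_re,
      Complex.normSq_eq_norm_sq]
  rw [← h4]
  exact Finset.single_le_sum (f := fun j => ‖(Xᴴ * M * X) j i‖ ^ 2) (fun j _ => sq_nonneg _)
    (Finset.mem_univ i)

/-- The right-hand side is the trace norm of `√σ√ρ`. -/
lemma trace_matSqrt_mul_le {ρ σ : Matrix m m ℂ} (hρ : ρ.PosSemidef) (hσ : σ.PosSemidef) :
    (matSqrt σ * matSqrt ρ).trace.re ≤ (matSqrt (matSqrt ρ * σ * matSqrt ρ)).trace.re := by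
  have h := norm_trace_le (matSqrt σ * matSqrt ρ)
  have h2 : (matSqrt σ * matSqrt ρ)ᴴ * (matSqrt σ * matSqrt ρ) = matSqrt ρ * σ * matSqrt ρ := by
    rw [conjTranspose_mul, (matSqrt_isHermitian hρ.1).eq, (matSqrt_isHermitian hσ.1).eq]
    conv_rhs => rw [← matSqrt_mul_self hσ]
    simp only [Matrix.mul_assoc]
  rw [h2] at h
  exact ((le_abs_self _).trans (Complex.abs_re_le_norm _)).trans h

/-- Jensen's inequality for `exp` with probability weights `r i |⟨w_j|u_i⟩|²`: the variable `(log (s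
j) - log (r i)) / 2` has mean `-D/2`. -/
lemma exp_neg_relEntropy_le {ρ σ : Matrix m m ℂ} (hρ : ρ.PosSemidef) (hσ : σ.PosSemidef)
    (hker : ∀ N : Matrix m m ℂ, σ * N = 0 → ρ * N = 0) (hρt : ρ.trace.re = 1) :
    Real.exp (-((ρ * matLog ρ).trace.re - (ρ * matLog σ).trace.re) / 2) ≤
      (matSqrt σ * matSqrt ρ).trace.re := by
  obtain ⟨U, r, hU, rfl⟩ := exists_diagConj hρ.1
  obtain ⟨W, s, hW, rfl⟩ := exists_diagConj hσ.1
  have hr := diagConj_nonneg hU hρ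
  have hs := diagConj_nonneg hW hσ
  obtain ⟨f1, f2, f3, -⟩ := trace_diagConj_mul_log hU hW r s 1
  simp only [Matrix.mul_one, Matrix.one_mul, conjTranspose_one] at f1 f2 f3
  have hsqrt : (matSqrt (diagConj W s) * matSqrt (diagConj U r)).trace.re =
      ∑ j, ∑ i, √(s j) * √(r i) * Complex.normSq ((Wᴴ * U) j i) := by
    have := trace_diagConj_mul_self W U 1 (fun j => √(s j)) (fun i => √(r i))
    simp only [Matrix.mul_one, conjTranspose_one] at this
    rw [matSqrt, matSqrt, cfc_diagConj hU, cfc_diagConj hW, this, Complex.ofReal_re]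
  rw [trace_mul_comm (diagConj U r) (matLog (diagConj W s)), hsqrt]
  set z := -((diagConj U r * matLog (diagConj U r)).trace.re -
    (matLog (diagConj W s) * diagConj U r).trace.re) / 2 with hz
  -- The tangent line of `exp` at the mean `z`, averaged over the weights, gives `exp z`.
  have hsum : Real.exp z = ∑ j, ∑ i, Real.exp z * ((1 - z) * (r i * Complex.normSq ((Wᴴ * U) j i)) +
      (Real.log (s j) * r i * Complex.normSq ((Wᴴ * U) j i) -
        r i * Real.log (r i) * Complex.normSq ((Wᴴ * U) j i)) / 2) := by
    simp only [← Finset.mul_sum, Finset.sum_add_distrib, ← Finset.sum_div, Finset.sum_sub_distrib]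
    rw [f1, f2, f3, hρt]
    have : (1 - z) * 1 + ((matLog (diagConj W s) * diagConj U r).trace.re -
        (diagConj U r * matLog (diagConj U r)).trace.re) / 2 = 1 := by
      rw [hz]
      ring
    rw [this, mul_one]
  rw [hsum]
  refine Finset.sum_le_sum fun j _ => Finset.sum_le_sum fun i _ => ?_
  have hy := Complex.normSq_nonneg ((Wᴴ * U) j i)
  rcases (hr i).eq_or_lt with h | h
  · rw [← h]
    simp
  by_cases hC : (Wᴴ * U) j i = 0
  · rw [hC]
    simp
  have hs' : 0 < s j := (hs j).lt_of_ne fun h0 => by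
    have := entry_eq_zero_of_mul_eq_zero hU hW (M := 1)
      (by simpa only [conjTranspose_one, Matrix.one_mul] using hker) (i := i) h0.symm
    rw [Matrix.mul_one] at this
    rcases mul_eq_zero.mp this with h' | h'
    · exact h.ne' (Complex.ofReal_eq_zero.mp h')
    · exact hC h'
  have hexp : Real.exp ((Real.log (s j) - Real.log (r i)) / 2) * r i = √(s j) * √(r i) := by
    have h1 : Real.exp ((Real.log (s j) - Real.log (r i)) / 2) = √(s j) / √(r i) := by
      rw [← Real.log_div hs'.ne' h.ne', ← Real.sqrt_div hs'.le, ← Real.log_sqrt (by positivity),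
        Real.exp_log (by positivity)]
    rw [h1, div_mul_eq_mul_div, div_eq_iff (by positivity), mul_assoc, Real.mul_self_sqrt h.le]
  have htan : Real.exp z * (1 - z + (Real.log (s j) - Real.log (r i)) / 2) ≤
      Real.exp ((Real.log (s j) - Real.log (r i)) / 2) := by
    have h1 := Real.add_one_le_exp ((Real.log (s j) - Real.log (r i)) / 2 - z)
    calc _ ≤ Real.exp z * Real.exp ((Real.log (s j) - Real.log (r i)) / 2 - z) :=
          mul_le_mul_of_nonneg_left (by linarith) (Real.exp_pos z).le
      _ = _ := by rw [← Real.exp_add, add_sub_cancel]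
  calc _ = Real.exp z * (1 - z + (Real.log (s j) - Real.log (r i)) / 2) *
        (r i * Complex.normSq ((Wᴴ * U) j i)) := by ring
    _ ≤ Real.exp ((Real.log (s j) - Real.log (r i)) / 2) * (r i * Complex.normSq ((Wᴴ * U) j i)) :=
        mul_le_mul_of_nonneg_right htan (mul_nonneg h.le hy)
    _ = _ := by rw [← mul_assoc, hexp]

lemma relEntropy_eq_coe {ρ σ : Matrix m m ℂ} (hρ : ρ.IsHermitian) (hσ : σ.IsHermitian)
    (hker : ∀ N : Matrix m m ℂ, σ * N = 0 → ρ * N = 0) :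
    relEntropy ρ σ = (((ρ * matLog ρ).trace.re - (ρ * matLog σ).trace.re : ℝ) : EReal) :=
  if_pos (range_mulVecLin_le hρ hσ hker)

/-- The relative entropy dominates the min-relative entropy `-log F`. -/
lemma negLogFidelity_le_relEntropy {ρ σ : Matrix m m ℂ} (hρ : ρ.PosSemidef) (hσ : σ.PosSemidef)
    (hker : ∀ N : Matrix m m ℂ, σ * N = 0 → ρ * N = 0) (hρt : ρ.trace.re = 1) :
    negLogFidelity ρ σ ≤ relEntropy ρ σ := by
  rw [relEntropy_eq_coe hρ.1 hσ.1 hker, negLogFidelity]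
  set D := (ρ * matLog ρ).trace.re - (ρ * matLog σ).trace.re
  have h1 : Real.exp (-D) ≤ fidelity ρ σ := by
    have h := (exp_neg_relEntropy_le hρ hσ hker hρt).trans (trace_matSqrt_mul_le hρ hσ)
    calc Real.exp (-D) = Real.exp (-D / 2) ^ 2 := by
          rw [← Real.exp_nat_mul]
          congr 1
          push_cast
          ring
      _ ≤ _ := pow_le_pow_left₀ (Real.exp_pos _).le h 2
  have hF := (Real.exp_pos _).trans_le h1
  rw [ENNReal.log_ofReal_of_pos hF, ← EReal.coe_neg, EReal.coe_le_coe_iff]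
  have := (Real.le_log_iff_exp_le hF).mpr h1
  linarith

end Fidelity

/-! ### The thermal state and its logarithm. -/

section Gibbs

variable {m : Type*} [Fintype m] [DecidableEq m]

lemma exp_diagConj {U : Matrix m m ℂ} (hU : Uᴴ * U = 1) (d : m → ℝ) :
    NormedSpace.exp (diagConj U d) = diagConj U (fun i => Real.exp (d i)) := by
  have hinv : U⁻¹ = Uᴴ := inv_eq_left_inv hU
  have hunit : IsUnit U := IsUnit.of_mul_eq_one _ (mul_eq_one_comm.mp hU)
  unfold diagConj
  rw [← hinv, exp_conj U _ hunit, exp_diagonal]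
  congr 3
  ext i
  rw [Pi.coe_exp, ← Complex.exp_eq_exp_ℂ, Complex.ofReal_exp]

lemma smul_diagConj (c : ℝ) (U : Matrix m m ℂ) (d : m → ℝ) :
    (c : ℂ) • diagConj U d = diagConj U (fun i => c * d i) := by
  unfold diagConj
  rw [← Matrix.smul_mul, ← Matrix.mul_smul, ← diagonal_smul]
  congr 3
  ext i
  simp

/-- The thermal state is positive definite, and its logarithm is `-βH - log Z`. -/
lemma exists_matLog_gibbs [Nonempty m] (β : ℝ) {H : Matrix m m ℂ} (hH : H.IsHermitian) :
    (gibbs β H).IsHermitian ∧ (∀ N : Matrix m m ℂ, gibbs β H * N = 0 → N = 0) ∧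
      ∃ z : ℝ, matLog (gibbs β H) = (-(β : ℂ)) • H - (z : ℂ) • 1 := by
  obtain ⟨U, h, hU, rfl⟩ := exists_diagConj hH
  set Z : ℝ := ∑ i, Real.exp (-β * h i) with hZ
  have hZpos : 0 < Z := Finset.sum_pos (fun i _ => Real.exp_pos _) Finset.univ_nonempty
  have hg : gibbs β (diagConj U h) = diagConj U (fun i => Z⁻¹ * Real.exp (-β * h i)) := by
    rw [gibbs, ← Complex.ofReal_neg, smul_diagConj, exp_diagConj hU, trace_diagConj hU,
      ← Complex.ofReal_inv, smul_diagConj]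
  rw [hg]
  refine ⟨diagConj_isHermitian _ _, fun N hN => ?_, Real.log Z, ?_⟩
  · have h1 : diagConj U (fun i => Z * Real.exp (β * h i)) *
        diagConj U (fun i => Z⁻¹ * Real.exp (-β * h i)) = 1 := by
      rw [diagConj_mul hU, ← diagConj_one hU]
      congr 1
      ext i
      rw [mul_mul_mul_comm, mul_inv_cancel₀ hZpos.ne', one_mul, ← Real.exp_add]
      simp
    rw [← Matrix.one_mul N, ← h1, Matrix.mul_assoc, hN, Matrix.mul_zero]
  · rw [matLog, cfc_diagConj hU, ← diagConj_one hU, ← Complex.ofReal_neg, smul_diagConj,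
      smul_diagConj]
    unfold diagConj
    rw [← Matrix.sub_mul, ← Matrix.mul_sub, diagonal_sub]
    congr 3
    ext i
    beta_reduce
    rw [Real.log_mul (by positivity) (Real.exp_pos _).ne', Real.log_exp, Real.log_inv]
    push_cast
    ring

/-- The constant `z` does not depend on the state, so it cancels in the difference of two relative
entropies. -/
lemma exists_relEntropy_gibbs [Nonempty m] (β : ℝ) {H : Matrix m m ℂ} (hH : H.IsHermitian) :
    ∃ z : ℝ, ∀ ρ : Matrix m m ℂ, IsDensity ρ → relEntropy ρ (gibbs β H) =
      (((ρ * matLog ρ).trace.re + β * (H * ρ).trace.re + z : ℝ) : EReal) := by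
  obtain ⟨h1, h2, z, h3⟩ := exists_matLog_gibbs β hH
  refine ⟨z, fun ρ hρ => ?_⟩
  rw [relEntropy_eq_coe hρ.1.1 h1 (fun N hN => by rw [h2 N hN, Matrix.mul_zero]), h3,
    Matrix.mul_sub, Matrix.mul_smul, Matrix.mul_smul, Matrix.mul_one, trace_sub, trace_smul,
    trace_smul, hρ.2, trace_mul_comm ρ H, ← Complex.ofReal_neg, Complex.sub_re, smul_eq_mul,
    smul_eq_mul, mul_one, Complex.ofReal_re, Complex.re_ofReal_mul]
  congr 1
  ring

end Gibbs

/-! ### Free energy with the battery. -/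

section Work

variable {n : Type*} [Fintype n] [DecidableEq n]

lemma batteryLevel_eq (i : Fin 2) :
    batteryLevel i = diagonal (fun k => (((if k = i then 1 else 0 : ℝ)) : ℂ)) := by
  ext a c
  fin_cases i <;> fin_cases a <;> fin_cases c <;> simp [batteryLevel, Matrix.single]

lemma diagConj_kronecker_batteryLevel (U : Matrix n n ℂ) (d : n → ℝ) (i : Fin 2) :
    diagConj U d ⊗ₖ batteryLevel i =
      diagConj (U ⊗ₖ (1 : Matrix (Fin 2) (Fin 2) ℂ))
        (fun x => d x.1 * if x.2 = i then 1 else 0) := by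
  unfold diagConj
  rw [conjTranspose_kronecker, conjTranspose_one]
  have : (diagonal fun x : n × Fin 2 => ((d x.1 * if x.2 = i then 1 else 0 : ℝ) : ℂ)) =
      diagonal (fun j => (d j : ℂ)) ⊗ₖ batteryLevel i := by
    rw [batteryLevel_eq, diagonal_kronecker_diagonal]
    congr 1
    ext x
    push_cast
    rfl
  rw [this, ← mul_kronecker_mul, ← mul_kronecker_mul, Matrix.one_mul, Matrix.mul_one]

/-- The convention `log 0 = 0` is essential: on the empty battery level both sides vanish. -/
lemma matLog_kronecker_batteryLevel {ω : Matrix n n ℂ} (hω : ω.IsHermitian) (i : Fin 2) :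
    matLog (ω ⊗ₖ batteryLevel i) = matLog ω ⊗ₖ batteryLevel i := by
  obtain ⟨U, d, hU, rfl⟩ := exists_diagConj hω
  have hU2 : (U ⊗ₖ (1 : Matrix (Fin 2) (Fin 2) ℂ))ᴴ * (U ⊗ₖ (1 : Matrix (Fin 2) (Fin 2) ℂ)) = 1 := by
    rw [conjTranspose_kronecker, ← mul_kronecker_mul, hU, conjTranspose_one, Matrix.one_mul,
      one_kronecker_one]
  rw [matLog, matLog, diagConj_kronecker_batteryLevel, cfc_diagConj hU2, cfc_diagConj hU,
    diagConj_kronecker_batteryLevel]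
  congr 1
  ext x
  split_ifs <;> simp

lemma batteryLevel_mul (i j : Fin 2) :
    batteryLevel i * batteryLevel j = if i = j then batteryLevel i else 0 := by
  split_ifs with h
  · rw [← h, batteryLevel, single_mul_single_same, one_mul]
  · exact single_mul_single_of_ne _ _ _ _ h _

lemma trace_batteryLevel (i : Fin 2) : (batteryLevel i).trace = 1 := by
  rw [batteryLevel, trace_single_eq_same]

lemma freeEnergy_battery (kT W : ℝ) (H : Matrix n n ℂ) {ω : Matrix n n ℂ} (hω : IsDensity ω)
    (i : Fin 2) :
    freeEnergy kT (systemBatteryHamiltonian H W) (ω ⊗ₖ batteryLevel i) =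
      (H * ω).trace.re + (if i = 1 then W else 0) + kT * (ω * matLog ω).trace.re := by
  have hE : entropy (ω ⊗ₖ batteryLevel i) = -(ω * matLog ω).trace.re := by
    rw [entropy, matLog_kronecker_batteryLevel hω.1.1, ← mul_kronecker_mul, batteryLevel_mul,
      if_pos rfl, trace_kronecker, trace_batteryLevel, mul_one]
  have hH : (systemBatteryHamiltonian H W * (ω ⊗ₖ batteryLevel i)).trace.re =
      (H * ω).trace.re + (if i = 1 then W else 0) := by
    rw [systemBatteryHamiltonian, Matrix.add_mul, ← mul_kronecker_mul, ← mul_kronecker_mul,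
      Matrix.one_mul, Matrix.one_mul, trace_add, trace_kronecker, trace_kronecker,
      trace_batteryLevel, mul_one, hω.2, one_mul, Matrix.smul_mul, batteryLevel_mul, trace_smul,
      Complex.add_re]
    by_cases h : i = 1
    · rw [if_pos h.symm, if_pos h, trace_batteryLevel]
      simp
    · rw [if_neg (Ne.symm h), if_neg h]
      simp
  rw [freeEnergy, hE, hH]
  ring

/-- The battery level is pure and adds no entropy; only the final state carries the energy `W`, so
the condition is an upper bound on `W`. -/
lemma allowedWork_eq (kT : ℝ) (H : Matrix n n ℂ) {ρ σ : Matrix n n ℂ} (hρ : IsDensity ρ)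
    (hσ : IsDensity σ) :
    allowedWork kT H ρ σ = Set.Iic (((H * ρ).trace.re + kT * (ρ * matLog ρ).trace.re) -
      ((H * σ).trace.re + kT * (σ * matLog σ).trace.re)) := by
  ext W
  rw [allowedWork, Set.mem_ofPred_eq, freeEnergy_battery kT W H hσ, freeEnergy_battery kT W H hρ,
    Set.mem_Iic, if_pos rfl, if_neg (by decide)]
  constructor <;> intro h <;> linarith

end Work

lemma nonempty_of_hilbertBasis {κ K : Type*} [NormedAddCommGroup K] [InnerProductSpace ℂ K]
    [Nontrivial K] (b : HilbertBasis κ ℂ K) : Nonempty κ := by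
  by_contra h
  rw [not_nonempty_iff] at h
  obtain ⟨x, hx⟩ := exists_ne (0 : K)
  exact hx ((b.hasSum_repr x).unique hasSum_empty)

end ThermalOp

end

/-! ### The recovery inequality and the work bound. -/

theorem theorem1 {n κ K : Type*} [Fintype n] [DecidableEq n]
    [NormedAddCommGroup K] [InnerProductSpace ℂ K] [CompleteSpace K] [Nontrivial K]
    (k T β : ℝ) (hk : 0 < k) (hT : 0 < T) (hβ : β = 1 / (k * T))
    (H : Matrix n n ℂ) (hH : H.IsHermitian)
    (b : HilbertBasis κ ℂ K) (E : κ → ℝ) (hE : Summable fun i => Real.exp (-β * E i))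
    (V : Matrix n n (K →L[ℂ] K)) (hV : ThermalOp.IsEnergyConservingUnitary b E H V)
    (ρ σ τ : Matrix n n ℂ) (hρ : ThermalOp.IsDensity ρ)
    (hσ : σ = ThermalOp.thermalMap b E β V ρ) (hτ : τ = ThermalOp.gibbs β H)
    (R : Matrix n n ℂ → Matrix n n ℂ) (hR : R = ThermalOp.recoveryMap b E β V) :
    ThermalOp.IsThermalOperation b E β H R ∧
    ThermalOp.relEntropy ρ τ - ThermalOp.relEntropy σ τ ≥ ThermalOp.relEntropy ρ (R σ) ∧
    ThermalOp.relEntropy ρ (R σ) ≥ ThermalOp.negLogFidelity ρ (R σ) ∧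
    IsGreatest (ThermalOp.allowedWork (k * T) H ρ σ) (ThermalOp.workGain (k * T) H ρ σ) ∧
    (ThermalOp.workGain (k * T) H ρ σ : EReal) =
      ((k * T : ℝ) : EReal) * (ThermalOp.relEntropy ρ τ - ThermalOp.relEntropy σ τ) ∧
    (ThermalOp.workGain (k * T) H ρ σ : EReal) ≥
      ((k * T : ℝ) : EReal) * ThermalOp.negLogFidelity ρ (R σ) := by
  open ThermalOp in
  have hκ : Nonempty κ := nonempty_of_hilbertBasis b
  have hn : Nonempty n := by
    by_contra h
    rw [not_nonempty_iff] at h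
    have := hρ.2
    simp [Matrix.trace] at this
  -- A summable family of strictly positive terms has a countable index set; the limit theorems for
  -- integrals in `relEntropy_recovered_le` need this.
  have hcount : Countable κ := by
    have h := hE.countable_support
    have hsupp : Function.support (fun i => Real.exp (-β * E i)) = Set.univ :=
      Set.eq_univ_of_forall fun i => (Real.exp_pos _).ne'
    rwa [hsupp, Set.countable_univ_iff] at h
  have hV1 : star V * V = 1 := (Unitary.mem_iff.mp hV.1).1
  have hV2 : V * star V = 1 := (Unitary.mem_iff.mp hV.1).2
  have hRth : IsThermalOperation b E β H R := hR ▸ recoveryMap_isThermalOperation hH hV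
  have hσd : IsDensity σ := hσ ▸ thermalMap_isDensity hE hV1 hρ
  have hσ'd : IsDensity (R σ) := by
    obtain ⟨U, hU, hRU⟩ := hRth
    rw [hRU]
    exact thermalMap_isDensity hE (Unitary.mem_iff.mp hU.1).1 hσd
  have hkraus := hσ ▸ hasSum_thermalMap (b := b) hE hV1 ρ
  have hkraus' : HasSum _ (R σ) := hR ▸ hasSum_recoveryMap (b := b) hE hV2 σ
  have hone := hasSum_weight_bathBlock (b := b) hE hV1
  have hp : ∀ a : κ × κ, 0 < bathWeight E β a.1 := fun a => bathWeight_pos hE a.1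
  have hq : ∀ a : κ × κ, 0 < bathWeight E β a.2 := fun a => bathWeight_pos hE a.2
  have hker := mul_eq_zero_of_recovered hp hq hρ.1 hσd.1 hone hkraus hkraus'
  have hmain := relEntropy_recovered_le hp hq hρ.1 hσd.1 hσ'd.1 hone hkraus hkraus'
    (by rw [hρ.2, Complex.one_re]) (by rw [hσ'd.2, Complex.one_re])
    (hasSum_heat hE hV1 hV.2 ρ)
  rw [← hσ] at hmain
  have hfid := negLogFidelity_le_relEntropy hρ.1 hσ'd.1 hker (by rw [hρ.2, Complex.one_re])
  obtain ⟨z, hz⟩ := exists_relEntropy_gibbs β hH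
  have hdiff : relEntropy ρ τ - relEntropy σ τ =
      (((ρ * matLog ρ).trace.re - (σ * matLog σ).trace.re +
        β * ((H * ρ).trace.re - (H * σ).trace.re) : ℝ) : EReal) := by
    rw [hτ, hz ρ hρ, hz σ hσd, ← EReal.coe_sub]
    congr 1
    ring
  have hrec : relEntropy ρ (R σ) ≤ relEntropy ρ τ - relEntropy σ τ := by
    rw [hdiff, relEntropy_eq_coe hρ.1.1 hσ'd.1.1 hker, EReal.coe_le_coe_iff]
    exact hmain
  have hkT : 0 < k * T := mul_pos hk hT
  have hwork : ((workGain (k * T) H ρ σ : ℝ) : EReal) =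
      ((k * T : ℝ) : EReal) * (relEntropy ρ τ - relEntropy σ τ) := by
    rw [hdiff, workGain, allowedWork_eq _ H hρ hσd, csSup_Iic, ← EReal.coe_mul, hβ]
    congr 1
    field_simp
    ring
  refine ⟨hRth, hrec, hfid, ?_, hwork, ?_⟩
  · rw [workGain, allowedWork_eq _ H hρ hσd, csSup_Iic]
    exact isGreatest_Iic
  · rw [hwork]
    exact mul_le_mul_of_nonneg_left (hfid.trans hrec) (EReal.coe_nonneg.mpr hkT.le)
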